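/- Let $\Bbbk$ be an algebraically closed field and let $\mathcal{C}$ be a unimodular ribbon category over $\Bbbk$: a $\Bbbk$-linear braided rigid monoidal category with bilinear tensor product, braiding $c$, dual $X^*$ with $\mathrm{ev}_X : X^* \otimes X \to \mathbb{1}$ and $\mathrm{coev}_X : \mathbb{1} \to X \otimes X^*$, and a twist, i.e. natural isomorphisms $\vartheta_X : X \to X$ with $\vartheta_{X \otimes Y} = (\vartheta_X \otimes \vartheta_Y) \circ c_{Y,X} \circ c_{X,Y}$ and $\vartheta_{X^*} = (\vartheta_X)^*$, such that $\mathcal{C}$ is linearly equivalent to the category of finite-dimensional left modules over a finite-dimensional $\Bbbk$-algebra, and such that the projective cover $P_{\mathbb{1}}$ of $\mathbb{1}$ satisfies $P_{\mathbb{1}}^* \cong P_{\mathbb{1}}$. Associativity and unit constraints, and the canonical isomorphisms $(X \otimes Y)^* \cong Y^* \otimes X^*$, $\mathbb{1}^* \cong \mathbb{1}$ and $X^{**} \cong X$ (the pivotal isomorphism determined by $\vartheta$), are suppressed. Then the end $\mathcal{E} = \int_{X \in \mathcal{C}} X \otimes X^*$ exists. Moreover, for every such end, with universal dinatural family $j_X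 : \mathcal{E} \to X \otimes X^*$, there are unique morphisms \[ \mu : \mathcal{E} \otimes \mathcal{E} \to \mathcal{E}, \quad \eta : \mathbb{1} \to \mathcal{E}, \quad \Delta : \mathcal{E} \to \mathcal{E} \otimes \mathcal{E}, \quad \varepsilon : \mathcal{E} \to \mathbb{1}, \quad S, S^{-1} : \mathcal{E} \to \mathcal{E}, \quad v_\pm : \mathbb{1} \to \mathcal{E}, \quad w_\pm : \mathbb{1} \to \mathcal{E} \otimes \mathcal{E} \] such that, for all $X, Y \in \mathcal{C}$, \begin{align*} j_X \circ \mu &= (\mathrm{id}_X \otimes \mathrm{ev}_X \otimes \mathrm{id}_{X^*}) \circ (j_X \otimes j_X), & j_X \circ \eta &= \mathrm{coev}_X, \\ (j_X \otimes j_Y) \circ \Delta &= (\mathrm{id}_X \otimes c_{Y \otimes Y^*,X^*}) \circ j_{X \otimes Y}, & \varepsilon &= j_{\mathbb{1}}, \\ j_X \circ S &= (\vartheta_X \otimes \mathrm{id}_{X^*}) \circ c_{X^*,X} \circ j_{X^*}, & j_X \circ S^{-1} &= (\vartheta_X^{-1} \otimes \mathrm{id}_{X^*}) \circ c_{X,X^*}^{-1}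 \circ j_{X^*}, \\ j_X \circ v_+ &= (\vartheta_X^{-1} \otimes \mathrm{id}_{X^*}) \circ \mathrm{coev}_X, & j_X \circ v_- &= (\vartheta_X \otimes \mathrm{id}_{X^*}) \circ \mathrm{coev}_X, \end{align*} \[ (j_X \otimes j_Y) \circ w_\pm = (\mathrm{id}_X \otimes (c_{Y,X^*} \circ c_{X^*,Y})^{\pm 1} \otimes \mathrm{id}_{Y^*}) \circ (\mathrm{coev}_X \otimes \mathrm{coev}_Y), \] and these morphisms make $\mathcal{E}$ into a BP-ribbon Hopf algebra in $\mathcal{C}$. That is, writing $c = c_{\mathcal{E},\mathcal{E}}$: \begin{itemize} \item[(0)] $(\mu,\eta,\Delta,\varepsilon,S)$ is a Hopf algebra in the braided category $\mathcal{C}$, $S^{-1}$ is inverse to $S$, and $w_+ = (\mu \otimes \mu) \circ (v_- \otimes (\Delta \circ v_+) \otimes v_-)$, $w_- = (\mu \otimes \mu) \circ (v_+ \otimes (c^{-1} \circ \Delta \circ v_-) \otimes v_+)$. \item[(i)] $v_+$ is central, invertible, normalized and antipode-invariant: $\mu \circ (v_+ \otimes \mathrm{id}) = \mu \circ (\mathrm{id}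 \otimes v_+)$, $\mu \circ (v_+ \otimes v_-) = \mu \circ (v_- \otimes v_+) = \eta$, $\varepsilon \circ v_+ = \mathrm{id}_{\mathbb{1}}$, $S \circ v_+ = v_+$. \item[(ii)] $w_+$ is a Hopf copairing: $(\Delta \otimes \mathrm{id}) \circ w_+ = (\mathrm{id} \otimes \mathrm{id} \otimes \mu) \circ (\mathrm{id} \otimes w_+ \otimes \mathrm{id}) \circ w_+$, $(\mathrm{id} \otimes \Delta) \circ w_+ = (\mu \otimes \mathrm{id} \otimes \mathrm{id}) \circ (\mathrm{id} \otimes w_+ \otimes \mathrm{id}) \circ w_+$, and $(\varepsilon \otimes \mathrm{id}) \circ w_+ = \eta = (\mathrm{id} \otimes \varepsilon) \circ w_+$. \item[(iii)] $v_+$ is compatible with the coproduct and $w_+$ with the braiding: with $\Omega := (\mu \otimes \mu) \circ (\mathrm{id} \otimes w_+ \otimes \mathrm{id})$ and with $\mu_2 := (\mu \otimes \mu) \circ (\mathrm{id} \otimes c \otimes \mathrm{id})$ the product of $\mathcal{E} \otimes \mathcal{E}$, \[ \Delta \circ \mu \circ (v_+ \otimes \mathrm{id}) = (\mu \otimes \mu)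 \circ (v_+ \otimes (\Omega \circ c^{-1} \circ \Delta) \otimes v_+), \qquad \Omega \circ c^{-1} \circ \Omega = \mu_2 \circ (\mu_2 \otimes \mathrm{id}_{\mathcal{E} \otimes \mathcal{E}}) \circ (w_+ \otimes c \otimes w_+). \] \end{itemize} -/

import Mathlib

open CategoryTheory MonoidalCategory Limits Opposite

universe w v u

/-! ### Finite, unimodular and ribbon categories -/

/-- A `k`-linear category is *finite* if it is equivalent, as a `k`-linear category, to the
category of finite-dimensional left modules over a finite-dimensional `k`-algebra `A`
(over such an `A`, finite-dimensional and finitely generated modules coincide). -/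
def IsFiniteLinearCategory (k : Type w) [Field k] (C : Type u) [Category.{v} C] [Preadditive C]
    [Linear k C] : Prop :=
  ∃ (A : Type w) (_ : Ring A) (_ : Algebra k A) (e : C ≌ FGModuleCat.{w} A)
    (_ : e.functor.Additive), FiniteDimensional k A ∧ e.functor.Linear k

/-- `p : P ⟶ X` is a projective cover: `P` is projective and `p` is an essential epimorphism. -/
structure IsProjectiveCover {C : Type u} [Category.{v} C] {P X : C} (p : P ⟶ X) : Prop where
  projective : Projective P
  epi : Epi p
  essential : ∀ {Q : C} (g : Q ⟶ P), Epi (g ≫ p) → Epi g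

/-- A rigid linear monoidal category is *unimodular* if it is finite and the projective cover of
the tensor unit is isomorphic to its own dual. -/
structure IsUnimodularCategory (k : Type w) [Field k] (C : Type u) [Category.{v} C]
    [Preadditive C] [Linear k C] [MonoidalCategory C] [RigidCategory C] : Prop where
  finite : IsFiniteLinearCategory k C
  selfDual : ∃ (P : C) (p : P ⟶ 𝟙_ C), IsProjectiveCover p ∧ Nonempty (Pᘁ ≅ P)

/-- A ribbon structure (twist) on a braided rigid monoidal category. The dual `X*` is Mathlib's
`Xᘁ`, with evaluation `Xᘁ ⊗ X ⟶ 𝟙_ C` and coevaluation `𝟙_ C ⟶ X ⊗ Xᘁ`. -/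
class RibbonCategory (C : Type u) [Category.{v} C] [MonoidalCategory C] [BraidedCategory C]
    [RigidCategory C] where
  /-- the twist isomorphisms -/
  twist : ∀ X : C, X ≅ X
  twist_naturality : ∀ {X Y : C} (f : X ⟶ Y), f ≫ (twist Y).hom = (twist X).hom ≫ f
  twist_tensor : ∀ X Y : C,
    (twist (X ⊗ Y)).hom = (β_ X Y).hom ≫ (β_ Y X).hom ≫ ((twist X).hom ⊗ₘ (twist Y).hom)
  twist_dual : ∀ X : C, (twist (Xᘁ)).hom = ((twist X).hom)ᘁ

/-! ### BP-ribbon Hopf algebras in a braided monoidal category -/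

section BPRibbon

variable {C : Type u} [Category.{v} C] [MonoidalCategory C]

/-- The structure morphisms of a BP-ribbon Hopf algebra. -/
@[ext]
structure BPRibbonData (H : C) where
  /-- the product -/
  mul : H ⊗ H ⟶ H
  /-- the unit -/
  one : 𝟙_ C ⟶ H
  /-- the coproduct -/
  comul : H ⟶ H ⊗ H
  /-- the counit -/
  counit : H ⟶ 𝟙_ C
  /-- the antipode -/
  antipode : H ⟶ H
  /-- the inverse antipode -/
  antipodeInv : H ⟶ H
  /-- the ribbon element `v₊` -/
  ribbon : 𝟙_ C ⟶ H
  /-- the inverse ribbon element `v₋` -/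
  ribbonInv : 𝟙_ C ⟶ H
  /-- the copairing `w₊` -/
  copairing : 𝟙_ C ⟶ H ⊗ H
  /-- the negative copairing `w₋` -/
  copairingNeg : 𝟙_ C ⟶ H ⊗ H

namespace BPRibbonData

variable {H : C} (D : BPRibbonData H)

/-- Left multiplication `x ↦ a x` by an element `a : 𝟙_ C ⟶ H`. -/
def leftMul (a : 𝟙_ C ⟶ H) : H ⟶ H := (λ_ H).inv ≫ a ▷ H ≫ D.mul

/-- Right multiplication `x ↦ x a` by an element `a : 𝟙_ C ⟶ H`. -/
def rightMul (a : 𝟙_ C ⟶ H) : H ⟶ H := (ρ_ H).inv ≫ H ◁ a ≫ D.mul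

/-- Insertion of `w₊` between two factors, `x ⊗ y ↦ x ⊗ w₊ ⊗ y`. -/
def insertCopairing : H ⊗ H ⟶ H ⊗ ((H ⊗ H) ⊗ H) :=
  H ◁ ((λ_ H).inv ≫ D.copairing ▷ H)

/-- The morphism `(μ ⊗ μ) ∘ (id ⊗ w₊ ⊗ id) : H ⊗ H ⟶ H ⊗ H`. -/
def innerCopairing : H ⊗ H ⟶ H ⊗ H :=
  D.insertCopairing ≫ H ◁ (α_ H H H).hom ≫ (α_ H H (H ⊗ H)).inv ≫ (D.mul ⊗ₘ D.mul)

variable [BraidedCategory C]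

/-- The product `(μ ⊗ μ) ∘ (id ⊗ c ⊗ id)` of the braided tensor product algebra `H ⊗ H`. -/
def mulTensor : (H ⊗ H) ⊗ (H ⊗ H) ⟶ H ⊗ H :=
  tensorμ H H H H ≫ (D.mul ⊗ₘ D.mul)

/-- The structure morphisms `D` make `H` into a BP-ribbon Hopf algebra. -/
structure IsBPRibbonHopf : Prop where
  /-- `H` is a Hopf algebra in the braided category `C` ... -/
  hopf : ∃ h : HopfObj H, h.mul = D.mul ∧ h.one = D.one ∧ h.comul = D.comul ∧
    h.counit = D.counit ∧ h.antipode = D.antipode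
  /-- ... with invertible antipode. -/
  antipode_antipodeInv : D.antipode ≫ D.antipodeInv = 𝟙 H
  antipodeInv_antipode : D.antipodeInv ≫ D.antipode = 𝟙 H
  /-- `w₊ = (μ ⊗ μ) ∘ (v₋ ⊗ (Δ ∘ v₊) ⊗ v₋)` -/
  copairing_eq : D.copairing =
    D.ribbon ≫ D.comul ≫ (D.leftMul D.ribbonInv ⊗ₘ D.rightMul D.ribbonInv)
  /-- `w₋ = (μ ⊗ μ) ∘ (v₊ ⊗ (c⁻¹ ∘ Δ ∘ v₋) ⊗ v₊)` -/
  copairingNeg_eq : D.copairingNeg =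
    D.ribbonInv ≫ D.comul ≫ (β_ H H).inv ≫ (D.leftMul D.ribbon ⊗ₘ D.rightMul D.ribbon)
  /-- (i) `v₊` is central, -/
  ribbon_central : D.leftMul D.ribbon = D.rightMul D.ribbon
  /-- invertible with inverse `v₋`, -/
  ribbon_ribbonInv : D.ribbonInv ≫ D.leftMul D.ribbon = D.one
  ribbonInv_ribbon : D.ribbon ≫ D.leftMul D.ribbonInv = D.one
  /-- normalized -/
  ribbon_counit : D.ribbon ≫ D.counit = 𝟙 (𝟙_ C)
  /-- and antipode-invariant. -/
  ribbon_antipode : D.ribbon ≫ D.antipode = D.ribbon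
  /-- (ii) `w₊` is a Hopf copairing:
  `(Δ ⊗ id) ∘ w₊ = (id ⊗ id ⊗ μ) ∘ (id ⊗ w₊ ⊗ id) ∘ w₊`, -/
  copairing_comul_left : D.copairing ≫ D.comul ▷ H =
    D.copairing ≫ D.insertCopairing ≫ H ◁ (α_ H H H).hom ≫ (α_ H H (H ⊗ H)).inv ≫
      (H ⊗ H) ◁ D.mul
  /-- `(id ⊗ Δ) ∘ w₊ = (μ ⊗ id ⊗ id) ∘ (id ⊗ w₊ ⊗ id) ∘ w₊`, -/
  copairing_comul_right : D.copairing ≫ H ◁ D.comul =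
    D.copairing ≫ D.insertCopairing ≫ H ◁ (α_ H H H).hom ≫ (α_ H H (H ⊗ H)).inv ≫
      D.mul ▷ (H ⊗ H)
  /-- `(ε ⊗ id) ∘ w₊ = η = (id ⊗ ε) ∘ w₊`. -/
  copairing_counit_left : D.copairing ≫ D.counit ▷ H ≫ (λ_ H).hom = D.one
  copairing_counit_right : D.copairing ≫ H ◁ D.counit ≫ (ρ_ H).hom = D.one
  /-- (iii) `v₊` is compatible with the coproduct: `Δ(v₊ x)` is obtained from `c⁻¹(Δ(x))` by
  inserting `w₊` and multiplying by `v₊` on both sides, -/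
  ribbon_comul : D.leftMul D.ribbon ≫ D.comul =
    D.comul ≫ (β_ H H).inv ≫ D.innerCopairing ≫ (D.leftMul D.ribbon ⊗ₘ D.rightMul D.ribbon)
  /-- and `w₊` with the braiding: the right-hand side is `x ⊗ y ↦ w₊ · c(x ⊗ y) · w₊`, the
  products being taken in the braided tensor product algebra `H ⊗ H`. -/
  copairing_braiding : D.innerCopairing ≫ (β_ H H).inv ≫ D.innerCopairing =
    (β_ H H).hom ≫
      ((λ_ (H ⊗ H)).inv ≫ D.copairing ▷ (H ⊗ H) ≫ D.mulTensor) ≫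
      ((ρ_ (H ⊗ H)).inv ≫ (H ⊗ H) ◁ D.copairing ≫ D.mulTensor)

end BPRibbonData

end BPRibbon

/-! ### The end of `X ⊗ X*` and its structure morphisms -/

section End

/-- The contravariant functor `X ↦ X*`, `f ↦ f*`. -/
@[simps]
def dualFunctor (C : Type u) [Category.{v} C] [MonoidalCategory C] [RigidCategory C] :
    Cᵒᵖ ⥤ C where
  obj X := (unop X)ᘁ
  map f := (f.unop)ᘁ
  map_id X := by simp
  map_comp f g := by simp [comp_rightAdjointMate]

/-- The functor `(Y, X) ↦ X ⊗ Y*`, whose end is `∫_X X ⊗ X*`. -/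
abbrev tensorDualFunctor (C : Type u) [Category.{v} C] [MonoidalCategory C] [RigidCategory C] :
    Cᵒᵖ ⥤ C ⥤ C :=
  dualFunctor C ⋙ tensoringRight C

variable {C : Type u} [Category.{v} C] [MonoidalCategory C] [RigidCategory C]

/-- The structure morphisms `j_X : E ⟶ X ⊗ X*` of a wedge for `(Y, X) ↦ X ⊗ Y*`. -/
def wedgeProj (W : Wedge (tensorDualFunctor C)) (X : C) : W.pt ⟶ X ⊗ Xᘁ := W.ι X

/-- The left evaluation `X* ⊗ X ⟶ 𝟙`. -/
def leftEv (X : C) : Xᘁ ⊗ X ⟶ 𝟙_ C := ε_ X Xᘁ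

/-- The left coevaluation `𝟙 ⟶ X ⊗ X*`. -/
def leftCoev (X : C) : 𝟙_ C ⟶ X ⊗ Xᘁ := η_ X Xᘁ

/-- The canonical isomorphism `(X ⊗ Y)* ≅ Y* ⊗ X*`. -/
def dualTensorIso (X Y : C) : (X ⊗ Y)ᘁ ≅ Yᘁ ⊗ Xᘁ := rightDualTensorIso X Y

variable [BraidedCategory C] [RibbonCategory C]

open RibbonCategory

/-- The right coevaluation `𝟙 ⟶ X* ⊗ X` determined by the ribbon structure. -/
def rightCoev (X : C) : 𝟙_ C ⟶ Xᘁ ⊗ X :=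
  leftCoev X ≫ (β_ X Xᘁ).hom ≫ Xᘁ ◁ (twist X).hom

/-- The inverse `X** ⟶ X` of the pivotal isomorphism determined by the ribbon structure. -/
def pivotalInv (X : C) : ((Xᘁ : C)ᘁ : C) ⟶ X :=
  (ρ_ _).inv ≫ ((Xᘁ : C)ᘁ : C) ◁ rightCoev X ≫ (α_ _ (Xᘁ) X).inv ≫ leftEv (Xᘁ : C) ▷ X ≫
    (λ_ X).hom

/-- The diagrammatic definition of the structure morphisms of the end `E`, through their
composition with the structure morphisms `j_X : E ⟶ X ⊗ X*`. The symbol `⊗≫` is composition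
with the canonical associativity and unit constraints inserted. -/
structure IsEndStructure {E : C} (j : ∀ X : C, E ⟶ X ⊗ Xᘁ) (D : BPRibbonData E) : Prop where
  /-- `j_X ∘ μ = (id ⊗ ev_X ⊗ id) ∘ (j_X ⊗ j_X)` -/
  mul : ∀ X : C, D.mul ≫ j X = (j X ⊗ₘ j X) ⊗≫ X ◁ (leftEv X ▷ Xᘁ) ⊗≫ 𝟙 (X ⊗ Xᘁ)
  /-- `j_X ∘ η = coev_X` -/
  one : ∀ X : C, D.one ≫ j X = leftCoev X
  /-- `(j_X ⊗ j_Y) ∘ Δ` is `j_{X ⊗ Y}`, followed by moving `X*` to the left of `Y ⊗ Y*`. -/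
  comul : ∀ X Y : C, D.comul ≫ (j X ⊗ₘ j Y) =
    j (X ⊗ Y) ⊗≫ (X ⊗ Y) ◁ (dualTensorIso X Y).hom ⊗≫ X ◁ (β_ (Y ⊗ Yᘁ) (Xᘁ)).hom ⊗≫
      𝟙 ((X ⊗ Xᘁ) ⊗ (Y ⊗ Yᘁ))
  /-- `ε = j_𝟙`, under `𝟙 ⊗ 𝟙* ≅ 𝟙* ≅ 𝟙* ⊗ 𝟙 ≅ 𝟙` -/
  counit : D.counit = j (𝟙_ C) ≫ (λ_ _).hom ≫ (ρ_ _).inv ≫ leftEv (𝟙_ C)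
  /-- `j_X ∘ S = (θ_X ⊗ id) ∘ c_{X*,X} ∘ j_{X*}`, where `X** = X` -/
  antipode : ∀ X : C, D.antipode ≫ j X =
    j (Xᘁ) ≫ Xᘁ ◁ pivotalInv X ≫ (β_ (Xᘁ) X).hom ≫ (twist X).hom ▷ Xᘁ
  /-- `j_X ∘ S⁻¹ = (θ_X⁻¹ ⊗ id) ∘ c_{X,X*}⁻¹ ∘ j_{X*}`, where `X** = X` -/
  antipodeInv : ∀ X : C, D.antipodeInv ≫ j X =
    j (Xᘁ) ≫ Xᘁ ◁ pivotalInv X ≫ (β_ X (Xᘁ)).inv ≫ (twist X).inv ▷ Xᘁ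
  /-- `j_X ∘ v₊ = (θ_X⁻¹ ⊗ id) ∘ coev_X` -/
  ribbon : ∀ X : C, D.ribbon ≫ j X = leftCoev X ≫ (twist X).inv ▷ Xᘁ
  /-- `j_X ∘ v₋ = (θ_X ⊗ id) ∘ coev_X` -/
  ribbonInv : ∀ X : C, D.ribbonInv ≫ j X = leftCoev X ≫ (twist X).hom ▷ Xᘁ
  /-- `(j_X ⊗ j_Y) ∘ w₊ = (id ⊗ (c_{Y,X*} ∘ c_{X*,Y}) ⊗ id) ∘ (coev_X ⊗ coev_Y)` -/
  copairing : ∀ X Y : C, D.copairing ≫ (j X ⊗ₘ j Y) =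
    𝟙 (𝟙_ C) ⊗≫ (leftCoev X ⊗ₘ leftCoev Y) ⊗≫
      X ◁ (((β_ (Xᘁ) Y).hom ≫ (β_ Y (Xᘁ)).hom) ▷ Yᘁ) ⊗≫ 𝟙 ((X ⊗ Xᘁ) ⊗ (Y ⊗ Yᘁ))
  /-- `(j_X ⊗ j_Y) ∘ w₋ = (id ⊗ (c_{Y,X*} ∘ c_{X*,Y})⁻¹ ⊗ id) ∘ (coev_X ⊗ coev_Y)` -/
  copairingNeg : ∀ X Y : C, D.copairingNeg ≫ (j X ⊗ₘ j Y) =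
    𝟙 (𝟙_ C) ⊗≫ (leftCoev X ⊗ₘ leftCoev Y) ⊗≫
      X ◁ (((β_ Y (Xᘁ)).inv ≫ (β_ (Xᘁ) Y).inv) ▷ Yᘁ) ⊗≫ 𝟙 ((X ⊗ Xᘁ) ⊗ (Y ⊗ Yᘁ))

end End

/-! By duality a family `Z ⟶ X ⊗ Xᘁ` is the same as a family `Z ⊗ X ⟶ X`, and the wedge condition
becomes naturality in `X`. The end is thus the universal object `E` acting naturally on every
object: it represents `Z ↦ Nat(Z ⊗ -, 𝟭)` (`isUniversalAction_wedgeAct`,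
`IsUniversalAction.hasEnd`).

Existence. Under the equivalence with modules the regular module gives an object `P` such that
natural actions on all objects are the same as actions on `P` commuting with `End P`. Hence `E` is
the subobject of `P ⊗ Pᘁ` on which `s ⊗ id` and `id ⊗ s*` agree for every `s : P ⟶ P`
(`IsDenseGenerator.exists_isUniversalAction`).

Structure. By rigidity, `E ⊗ E` represents the parametrized endomorphisms of `X ⊗ Y` natural in both
variables (`exists_lift₂`, `hom_ext₂`). Every structure morphism then has a plain meaning, recorded
in `IsActionStructure`: the product composes actions, the coproduct is the action on `X ⊗ Y`, the
counit is the action on `𝟙_ C`, the antipode transfers the action from `Xᘁ` to `X` across the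
coevaluation, `v₊` acts by the inverse twist and `w₊` by the inverse double braiding. The axioms
become facts about `C`: the bialgebra laws follow from naturality of the action, centrality of `v₊`
from naturality at the twist, the relations between `v₊` and `w₊` from the formula for the twist of
`X ⊗ Y`, the copairing laws from the hexagons, and antipode invariance from compatibility of the
twist with duals.

It remains to translate between the actions and the diagrams in `IsEndStructure`, by closing each
leg `X ⊗ Xᘁ` with an evaluation (`hom_ext_leftCap`). -/

section Proofs

open BraidedCategory RibbonCategory

/-! ### Natural actions and wedges -/

section UniversalAction

variable {C : Type u} [Category.{v} C] [MonoidalCategory C]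

/-- A family of morphisms `E ⊗ X ⟶ X`, natural in `X`, that is universal among all such families:
`E` represents the functor `Z ↦ Nat(Z ⊗ -, 𝟭)`. -/
structure IsUniversalAction {E : C} (a : ∀ X : C, E ⊗ X ⟶ X) : Prop where
  naturality : ∀ {X Y : C} (f : X ⟶ Y), E ◁ f ≫ a Y = a X ≫ f
  exists_lift : ∀ {Z : C} (t : ∀ X : C, Z ⊗ X ⟶ X),
    (∀ {X Y : C} (f : X ⟶ Y), Z ◁ f ≫ t Y = t X ≫ f) → ∃ f : Z ⟶ E, ∀ X, f ▷ X ≫ a X = t X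
  hom_ext : ∀ {Z : C} {f g : Z ⟶ E}, (∀ X, f ▷ X ≫ a X = g ▷ X ≫ a X) → f = g

variable [RigidCategory C]

/-- The morphism `Z ⊗ X ⟶ Y` adjoint to `f : Z ⟶ Y ⊗ X*`. -/
def uncurryDual {Z X Y : C} (f : Z ⟶ Y ⊗ Xᘁ) : Z ⊗ X ⟶ Y :=
  (tensorRightHomEquiv Z X Xᘁ Y).symm f

lemma uncurryDual_eq {Z X Y : C} (f : Z ⟶ Y ⊗ Xᘁ) :
    uncurryDual f = f ▷ X ≫ (α_ _ _ _).hom ≫ Y ◁ leftEv X ≫ (ρ_ _).hom := rfl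

lemma uncurryDual_injective {Z X Y : C} :
    Function.Injective (uncurryDual : (Z ⟶ Y ⊗ Xᘁ) → (Z ⊗ X ⟶ Y)) :=
  (tensorRightHomEquiv Z X Xᘁ Y).symm.injective

lemma uncurryDual_surjective {Z X Y : C} :
    Function.Surjective (uncurryDual : (Z ⟶ Y ⊗ Xᘁ) → (Z ⊗ X ⟶ Y)) :=
  (tensorRightHomEquiv Z X Xᘁ Y).symm.surjective

lemma uncurryDual_comp_left {Z Z' X Y : C} (g : Z' ⟶ Z) (f : Z ⟶ Y ⊗ Xᘁ) :
    uncurryDual (g ≫ f) = g ▷ X ≫ uncurryDual f := by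
  simp [uncurryDual_eq]

lemma uncurryDual_comp_right {Z X Y Y' : C} (f : Z ⟶ Y ⊗ Xᘁ) (g : Y ⟶ Y') :
    uncurryDual (f ≫ g ▷ Xᘁ) = uncurryDual f ≫ g := by
  simp only [uncurryDual_eq, comp_whiskerRight, Category.assoc, associator_naturality_left_assoc]
  rw [← whisker_exchange_assoc]; simp

lemma leftCoev_comp_rightAdjointMate {X Y : C} (f : X ⟶ Y) :
    leftCoev Y ≫ Y ◁ fᘁ = leftCoev X ≫ f ▷ Xᘁ :=
  coevaluation_comp_rightAdjointMate f

lemma rightAdjointMate_comp_leftEv {X Y : C} (f : X ⟶ Y) :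
    fᘁ ▷ X ≫ leftEv X = Yᘁ ◁ f ≫ leftEv Y :=
  rightAdjointMate_comp_evaluation f

lemma uncurryDual_comp_rightAdjointMate {Z X Y W : C} (f : Z ⟶ W ⊗ Yᘁ) (g : X ⟶ Y) :
    uncurryDual (f ≫ W ◁ gᘁ) = Z ◁ g ≫ uncurryDual f := by
  simp only [uncurryDual_eq, comp_whiskerRight, Category.assoc, whisker_assoc,
    Iso.inv_hom_id_assoc]
  rw [← whiskerLeft_comp_assoc, rightAdjointMate_comp_leftEv, whisker_exchange_assoc]
  simp

/-- Under the adjunction, `f ▷ Xᘁ` becomes composition with `f` on the target and `Y ◁ fᘁ` becomes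
composition with `f` on the source. -/
lemma dinatural_iff_natural {Z X Y : C} (s : Z ⟶ X ⊗ Xᘁ) (t : Z ⟶ Y ⊗ Yᘁ) (f : X ⟶ Y) :
    s ≫ f ▷ Xᘁ = t ≫ Y ◁ fᘁ ↔ Z ◁ f ≫ uncurryDual t = uncurryDual s ≫ f := by
  rw [← uncurryDual_comp_right, ← uncurryDual_comp_rightAdjointMate,
    uncurryDual_injective.eq_iff, eq_comm]

lemma uncurryDual_leftCoev (X : C) : uncurryDual (leftCoev X) = (λ_ X).hom := by
  simp [uncurryDual_eq, leftCoev, leftEv]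

/-- The action `E ⊗ X ⟶ X` given by a wedge `E ⟶ X ⊗ X*`. -/
def wedgeAct (W : Wedge (tensorDualFunctor C)) (X : C) : W.pt ⊗ X ⟶ X :=
  uncurryDual (wedgeProj W X)

lemma wedgeProj_condition (W : Wedge (tensorDualFunctor C)) {X Y : C} (f : X ⟶ Y) :
    wedgeProj W X ≫ f ▷ Xᘁ = wedgeProj W Y ≫ Y ◁ fᘁ :=
  Wedge.condition W f

lemma wedgeProj_hom_ext {W : Wedge (tensorDualFunctor C)} (hW : IsLimit W) {Z : C}
    {f g : Z ⟶ W.pt} (h : ∀ X, f ≫ wedgeProj W X = g ≫ wedgeProj W X) : f = g :=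
  Wedge.IsLimit.hom_ext hW h

lemma isUniversalAction_wedgeAct {W : Wedge (tensorDualFunctor C)} (hW : IsLimit W) :
    IsUniversalAction (wedgeAct W) where
  naturality f := (dinatural_iff_natural _ _ f).1 (wedgeProj_condition W f)
  exists_lift {Z} t ht := by
    choose s hs using fun X => uncurryDual_surjective (t X)
    have hs' : ∀ {X Y : C} (f : X ⟶ Y), s X ≫ f ▷ Xᘁ = s Y ≫ Y ◁ fᘁ := fun f => by
      rw [dinatural_iff_natural, hs, hs, ht]
    refine ⟨Wedge.IsLimit.lift hW s fun _ _ f => hs' f, fun X => ?_⟩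
    rw [wedgeAct, ← uncurryDual_comp_left, ← hs]
    exact congrArg _ (Wedge.IsLimit.lift_ι hW s _ X)
  hom_ext {Z f g} h := wedgeProj_hom_ext hW fun X => uncurryDual_injective <| by
    rw [uncurryDual_comp_left, uncurryDual_comp_left]; exact h X

lemma IsUniversalAction.hasEnd {E : C} {a : ∀ X : C, E ⊗ X ⟶ X} (ha : IsUniversalAction a) :
    HasEnd (tensorDualFunctor C) := by
  choose j hj using fun X => uncurryDual_surjective (a X)
  let W : Wedge (tensorDualFunctor C) := Wedge.mk E j fun X Y f =>
    (dinatural_iff_natural (j X) (j Y) f).2 (by rw [hj, hj, ha.naturality])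
  have key : ∀ s : Wedge (tensorDualFunctor C), ∃ f : s.pt ⟶ E, ∀ X, f ≫ j X = s.ι X := fun s => by
    obtain ⟨f, hf⟩ := ha.exists_lift (wedgeAct s)
      fun f => (dinatural_iff_natural _ _ f).1 (wedgeProj_condition s f)
    exact ⟨f, fun X => uncurryDual_injective <| by rw [uncurryDual_comp_left, hj, hf]; rfl⟩
  refine ⟨⟨⟨W, Multifork.IsLimit.mk W (fun s => (key s).choose) (fun s => (key s).choose_spec) ?_⟩⟩⟩
  intro s (m : s.pt ⟶ E) hm
  refine ha.hom_ext fun X => ?_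
  rw [← hj X, ← uncurryDual_comp_left, ← uncurryDual_comp_left, (key s).choose_spec]
  exact congrArg _ (hm X)

end UniversalAction

/-! ### Existence of the universal action in a finite category -/

section Existence

/-- The regular module is dense among finitely generated modules. -/
lemma FGModuleCat.exists_hom_of_equivariant {A : Type w} [Ring A] {G X V : FGModuleCat.{w} A}
    (i : G ≅ FGModuleCat.of A A) (h : (G ⟶ X) → (G ⟶ V))
    (hadd : ∀ p q, h (p + q) = h p + h q)
    (hs : ∀ (s : G ⟶ G) (p : G ⟶ X), h (s ≫ p) = s ≫ h p) :
    ∃ f : X ⟶ V, ∀ p, h p = p ≫ f := by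
  -- An element `x` is encoded as the morphism `m x` sending the generator `g` to `x`. Right
  -- multiplication `r b` is an endomorphism of the regular module, so equivariance of `h` under `r
  -- b` is exactly what makes `φ` below `A`-linear.
  let m (x : X) : G ⟶ X := i.hom ≫ FGModuleCat.ofHom (LinearMap.toSpanSingleton A X x)
  let r (b : A) : G ⟶ G := i.hom ≫ FGModuleCat.ofHom (LinearMap.toSpanSingleton A A b) ≫ i.inv
  have hi : ∀ y : G, i.inv.hom.hom (i.hom.hom.hom y) = y := fun y =>
    LinearMap.congr_fun (congrArg (fun f => f.hom.hom) i.hom_inv_id) y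
  have hi' : ∀ y : A, i.hom.hom.hom (i.inv.hom.hom y) = y := fun y =>
    LinearMap.congr_fun (congrArg (fun f => f.hom.hom) i.inv_hom_id) y
  let g : G := i.inv.hom.hom (1 : A)
  have m_add : ∀ x y, m (x + y) = m x + m y := fun x y => by
    ext z
    exact smul_add (i.hom.hom.hom z : A) x y
  have r_m : ∀ (b : A) x, m (b • x) = r b ≫ m x := fun b x => by
    ext z
    change (i.hom.hom.hom z : A) • b • x = (i.hom.hom.hom (i.inv.hom.hom _) : A) • x
    rw [hi', smul_smul]
    rfl
  have r_g : ∀ b : A, (r b).hom.hom g = b • g := fun b => by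
    change i.inv.hom.hom ((i.hom.hom.hom (i.inv.hom.hom (1 : A)) : A) • b) =
      b • i.inv.hom.hom (1 : A)
    rw [hi', one_smul, ← map_smul, smul_eq_mul, mul_one]
  have gen : ∀ y : G, y = (i.hom.hom.hom y : A) • g := fun y => by
    change _ = (i.hom.hom.hom y : A) • i.inv.hom.hom (1 : A)
    rw [← map_smul, smul_eq_mul, mul_one, hi]
  let φ : X →ₗ[A] V :=
    { toFun := fun x => (h (m x)).hom.hom g
      map_add' := fun x y => by rw [m_add, hadd]; rfl
      map_smul' := fun b x => by
        rw [r_m, hs]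
        change (h (m x)).hom.hom ((r b).hom.hom g) = _
        rw [r_g, map_smul]; rfl }
  refine ⟨ObjectProperty.homMk (ModuleCat.ofHom φ), fun p => ?_⟩
  have hp : m (p.hom.hom g) = p := by
    ext z
    change (i.hom.hom.hom z : A) • p.hom.hom g = p.hom.hom z
    rw [← map_smul, ← gen]
  ext y
  change (h p).hom.hom y = (h (m (p.hom.hom y))).hom.hom g
  have : m (p.hom.hom y) = r (i.hom.hom.hom y) ≫ p := by
    conv_lhs => rw [gen y]
    rw [map_smul, r_m, hp]
  rw [this, hs]
  change _ = (h p).hom.hom ((r _).hom.hom g)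
  rw [r_g, ← gen]

/-- Every element is the image of `1` under some map from the regular module. -/
lemma FGModuleCat.hom_ext_of_regular {A : Type w} [Ring A] {G X V : FGModuleCat.{w} A}
    (i : G ≅ FGModuleCat.of A A) {f g : X ⟶ V} (h : ∀ p : G ⟶ X, p ≫ f = p ≫ g) : f = g := by
  ext x
  have := congrArg (fun f => i.inv ≫ f)
    (h (i.hom ≫ FGModuleCat.ofHom (LinearMap.toSpanSingleton A X x)))
  simp only [Category.assoc, Iso.inv_hom_id_assoc] at this
  have := LinearMap.congr_fun (congrArg (fun f => f.hom.hom) this) (1 : A)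
  change f.hom.hom ((1 : A) • x) = g.hom.hom ((1 : A) • x) at this
  rwa [one_smul] at this

/-- Over a Noetherian ring, arbitrary families of parallel pairs have a joint equalizer. -/
lemma FGModuleCat.exists_joint_equalizer {A : Type w} [Ring A] [IsNoetherianRing A]
    {ι : Type*} {Q V : FGModuleCat.{w} A} (g g' : ι → (Q ⟶ V)) :
    ∃ (K : FGModuleCat.{w} A) (κ : K ⟶ Q), Mono κ ∧ (∀ i, κ ≫ g i = κ ≫ g' i) ∧
      ∀ (Z : FGModuleCat.{w} A) (z : Z ⟶ Q), (∀ i, z ≫ g i = z ≫ g' i) → ∃ u, u ≫ κ = z := by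
  -- The intersection may be infinite; it stays finitely generated because `A` is Noetherian and `Q`
  -- is finitely generated.
  let N : Submodule A Q := ⨅ i, LinearMap.eqLocus (g i).hom.hom (g' i).hom.hom
  have hN : ∀ y : Q, y ∈ N ↔ ∀ i, (g i).hom.hom y = (g' i).hom.hom y := fun y => by
    simp [N, Submodule.mem_iInf]
  let κ : FGModuleCat.of A N ⟶ Q := ObjectProperty.homMk (ModuleCat.ofHom N.subtype)
  refine ⟨FGModuleCat.of A N, κ, ⟨fun {Z} s t h => ?_⟩, fun i => ?_, fun Z z hz => ?_⟩
  · ext y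
    have := LinearMap.congr_fun (congrArg (fun f => f.hom.hom) h) y
    exact this
  · ext y
    exact (hN _).1 y.2 i
  · refine ⟨ObjectProperty.homMk (ModuleCat.ofHom (LinearMap.codRestrict N z.hom.hom
      fun y => ?_)), ?_⟩
    · exact (hN _).2 fun i => LinearMap.congr_fun (congrArg (fun f => f.hom.hom) (hz i)) y
    · ext y; rfl

/-- An object `P` is a *dense generator* of a preadditive category if morphisms `X ⟶ V` are the
same as additive `End P`-equivariant maps `Hom(P, X) → Hom(P, V)`. -/
structure IsDenseGenerator {C : Type u} [Category.{v} C] [Preadditive C] (P : C) : Prop where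
  exists_hom : ∀ {X V : C} (h : (P ⟶ X) → (P ⟶ V)), (∀ p q, h (p + q) = h p + h q) →
    (∀ (s : P ⟶ P) (p : P ⟶ X), h (s ≫ p) = s ≫ h p) → ∃ f : X ⟶ V, ∀ p, h p = p ≫ f
  hom_ext : ∀ {X V : C} {f g : X ⟶ V}, (∀ p : P ⟶ X, p ≫ f = p ≫ g) → f = g

/-- `C` has joint equalizers of families of parallel pairs `Q ⇉ V`. -/
def HasJointEqualizers (C : Type u) [Category.{v} C] : Prop :=
  ∀ {ι : Type v} {Q V : C} (g g' : ι → (Q ⟶ V)), ∃ (K : C) (κ : K ⟶ Q), Mono κ ∧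
    (∀ i, κ ≫ g i = κ ≫ g' i) ∧
      ∀ (Z : C) (z : Z ⟶ Q), (∀ i, z ≫ g i = z ≫ g' i) → ∃ u, u ≫ κ = z

variable {k : Type w} [Field k] {C : Type u} [Category.{v} C] [Preadditive C] [Linear k C]

lemma IsFiniteLinearCategory.exists_isDenseGenerator (hC : IsFiniteLinearCategory k C) :
    ∃ P : C, IsDenseGenerator P := by
  obtain ⟨A, _, _, e, _, _, _⟩ := hC
  let F := e.functor
  let i : F.obj (e.inverse.obj (FGModuleCat.of A A)) ≅ FGModuleCat.of A A := e.counitIso.app _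
  refine ⟨e.inverse.obj (FGModuleCat.of A A), ⟨fun {X V} h hadd hs => ?_, fun {X V f g} h => ?_⟩⟩
  · obtain ⟨f, hf⟩ := FGModuleCat.exists_hom_of_equivariant i
      (fun p : _ ⟶ F.obj X => F.map (h (F.preimage p)))
      (fun p q => by
        rw [← F.map_add, ← hadd]; congr 2; exact F.map_injective (by simp))
      (fun s p => by
        rw [← F.map_preimage s, ← F.map_comp, ← hs]; congr 2; exact F.map_injective (by simp))
    refine ⟨F.preimage f, fun p => F.map_injective ?_⟩
    simpa using hf (F.map p)
  · refine F.map_injective (FGModuleCat.hom_ext_of_regular i fun p => ?_)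
    simpa using congrArg F.map (h (F.preimage p))

lemma IsFiniteLinearCategory.hasJointEqualizers (hC : IsFiniteLinearCategory k C) :
    HasJointEqualizers C := by
  obtain ⟨A, _, _, e, _, _, _⟩ := hC
  have : IsNoetherianRing A := isNoetherian_of_tower k inferInstance
  let F := e.functor
  intro ι Q V g g'
  obtain ⟨K, κ, hκ, hg, hu⟩ :=
    FGModuleCat.exists_joint_equalizer (fun i => F.map (g i)) (fun i => F.map (g' i))
  let i := e.counitIso.app K
  have hκ' : F.map (F.preimage (i.hom ≫ κ)) = i.hom ≫ κ := F.map_preimage _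
  refine ⟨e.inverse.obj K, F.preimage (i.hom ≫ κ), ?_, fun a => F.map_injective ?_,
    fun Z z hz => ?_⟩
  · have : Mono (F.map (F.preimage (i.hom ≫ κ))) := by rw [hκ']; exact mono_comp _ _
    exact F.mono_of_mono_map this
  · rw [F.map_comp, F.map_comp, hκ', Category.assoc, Category.assoc, hg]
  · obtain ⟨u, hu⟩ := hu _ (F.map z) fun a => by rw [← F.map_comp, ← F.map_comp, hz]
    exact ⟨F.preimage (u ≫ i.inv), F.map_injective <| by
      rw [F.map_comp, hκ', F.map_preimage]
      simp [hu]⟩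

variable [MonoidalCategory C] [RigidCategory C]

/-- `Z ⊗ -` is left adjoint to `(ᘁZ) ⊗ -`, so it preserves the joint epimorphy of the maps out of
`P`. -/
lemma IsDenseGenerator.whiskerLeft_hom_ext {P : C} (hP : IsDenseGenerator P) {Z X V : C}
    {f g : Z ⊗ X ⟶ V} (h : ∀ p : P ⟶ X, Z ◁ p ≫ f = Z ◁ p ≫ g) : f = g := by
  let e (Y : C) : (Z ⊗ Y ⟶ V) ≃ (Y ⟶ (ᘁZ) ⊗ V) := tensorLeftHomEquiv Y (ᘁZ) Z V
  have nat : ∀ {Y Y' : C} (f : Y ⟶ Y') (g : Z ⊗ Y' ⟶ V), e Y (Z ◁ f ≫ g) = f ≫ e Y' g :=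
    fun f g => by
      rw [← Equiv.eq_symm_apply]
      refine (Eq.trans (tensorLeftHomEquiv_symm_naturality f _) ?_).symm
      exact congrArg _ ((e _).symm_apply_apply g)
  exact (e X).injective (hP.hom_ext fun p => by rw [← nat, ← nat, h])

variable [MonoidalPreadditive C]

/-- An action on a dense generator extends to all objects. -/
lemma IsDenseGenerator.exists_extension {P : C} (hP : IsDenseGenerator P) {Z : C} (t : Z ⊗ P ⟶ P)
    (ht : ∀ s : P ⟶ P, Z ◁ s ≫ t = t ≫ s) (X : C) :
    ∃ tX : Z ⊗ X ⟶ X, ∀ p : P ⟶ X, Z ◁ p ≫ tX = t ≫ p := by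
  let e (Y : C) : (Z ⊗ Y ⟶ X) ≃ (Y ⟶ (ᘁZ) ⊗ X) := tensorLeftHomEquiv Y (ᘁZ) Z X
  have nat : ∀ {Y Y' : C} (f : Y ⟶ Y') (g : Z ⊗ Y' ⟶ X), e Y (Z ◁ f ≫ g) = f ≫ e Y' g :=
    fun f g => by
      rw [← Equiv.eq_symm_apply]
      refine (Eq.trans (tensorLeftHomEquiv_symm_naturality f _) ?_).symm
      exact congrArg _ ((e _).symm_apply_apply g)
  have add : ∀ {Y : C} (f g : Z ⊗ Y ⟶ X), e Y (f + g) = e Y f + e Y g := fun f g => by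
    simp [e, tensorLeftHomEquiv]
  -- Passing to the adjoint turns the unknown `Z ⊗ X ⟶ X` into a morphism out of `X`, which density
  -- produces from its prescribed composites with the maps `p`; `ht` gives the equivariance.
  obtain ⟨f, hf⟩ := hP.exists_hom (fun p : P ⟶ X => e P (t ≫ p))
    (fun p q => by rw [← add, Preadditive.comp_add])
    (fun s p => by rw [← nat, ← Category.assoc, ← ht, Category.assoc])
  refine ⟨(e X).symm f, fun p => (e P).injective ?_⟩
  rw [hf, nat, Equiv.apply_symm_apply]

/-- Maps into the joint equalizer in `P ⊗ Pᘁ` are the actions on `P` that commute with `End P`.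
Density extends each of them uniquely to all objects, and the same uniqueness gives naturality. -/
lemma IsDenseGenerator.exists_isUniversalAction {P : C} (hP : IsDenseGenerator P)
    (hC : HasJointEqualizers C) :
    ∃ (E : C) (a : ∀ X : C, E ⊗ X ⟶ X), IsUniversalAction a := by
  obtain ⟨E, κ, _, hκ, hE⟩ := hC (fun s : P ⟶ P => s ▷ Pᘁ) (fun s => P ◁ sᘁ)
  have key : ∀ {Z : C} (z : Z ⟶ P ⊗ Pᘁ) (s : P ⟶ P), z ≫ s ▷ Pᘁ = z ≫ P ◁ sᘁ ↔
      Z ◁ s ≫ uncurryDual z = uncurryDual z ≫ s := fun z s => dinatural_iff_natural z z s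
  choose a ha using hP.exists_extension (uncurryDual κ) fun s => (key _ _).1 (hκ s)
  have haP : a P = uncurryDual κ := by simpa using ha P (𝟙 P)
  refine ⟨E, a, ⟨fun {X Y} f => ?_, fun {Z} t ht => ?_, fun {Z f g} h => ?_⟩⟩
  · refine hP.whiskerLeft_hom_ext fun p => ?_
    rw [← whiskerLeft_comp_assoc, ha, reassoc_of% ha]
  · obtain ⟨z, hz⟩ := uncurryDual_surjective (t P)
    obtain ⟨u, hu⟩ := hE Z z fun s => (key _ _).2 (by rw [hz, ht])
    refine ⟨u, fun X => hP.whiskerLeft_hom_ext fun p => ?_⟩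
    rw [whisker_exchange_assoc, ha, ht, ← reassoc_of% uncurryDual_comp_left, hu, hz]
  · rw [← cancel_mono κ]
    refine uncurryDual_injective ?_
    rw [uncurryDual_comp_left, uncurryDual_comp_left, ← haP, h]

end Existence

/-! ### Faithful actions and lifting into tensor products -/

section Action

variable {C : Type u} [Category.{v} C] [MonoidalCategory C]

/-- A family of morphisms `M ⊗ X i ⟶ Y i` that jointly detects morphisms into `M`. -/
def IsFaithfulAction {ι : Type*} {M : C} {X Y : ι → C} (a : ∀ i, M ⊗ X i ⟶ Y i) : Prop :=
  ∀ ⦃Z : C⦄ ⦃f g : Z ⟶ M⦄, (∀ i, f ▷ X i ≫ a i = g ▷ X i ≫ a i) → f = g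

lemma IsUniversalAction.isFaithfulAction {E : C} {a : ∀ X : C, E ⊗ X ⟶ X}
    (ha : IsUniversalAction a) : IsFaithfulAction a :=
  fun _ _ _ h => ha.hom_ext h

section Braiding

variable [BraidedCategory C]

/-- Naturality of the braiding at `η`, split by a hexagon: `X` crosses both legs of a cup exactly
when it passes the cup freely. -/
lemma coev_braiding_slide {A B : C} (η : 𝟙_ C ⟶ A ⊗ B) (X : C) :
    η ▷ X ≫ (α_ A B X).hom ≫ A ◁ (β_ B X).hom ≫ (α_ A X B).inv ≫ (β_ A X).hom ▷ B ≫
      (α_ X A B).hom = (λ_ X).hom ≫ (ρ_ X).inv ≫ X ◁ η := by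
  have h := braiding_naturality_left η X
  rw [braiding_tensor_left_hom, braiding_tensorUnit_left] at h
  simpa using h

end Braiding

variable [RigidCategory C]

/-- Bend `V` to the source, lift the resulting natural action of `Vᘁ ⊗ W`, and bend back; a zigzag
identity restores `t`. -/
lemma IsUniversalAction.exists_lift_left {E : C} {a : ∀ X : C, E ⊗ X ⟶ X}
    (ha : IsUniversalAction a) {V W : C} (t : ∀ Y : C, W ⊗ Y ⟶ V ⊗ Y)
    (ht : ∀ {X Y : C} (f : X ⟶ Y), W ◁ f ≫ t Y = t X ≫ V ◁ f) :
    ∃ f : W ⟶ V ⊗ E, ∀ Y, f ▷ Y ≫ (α_ _ _ _).hom ≫ V ◁ a Y = t Y := by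
  obtain ⟨g, hg⟩ := ha.exists_lift
    (fun Y => (α_ Vᘁ W Y).hom ≫ Vᘁ ◁ t Y ≫ (α_ _ _ _).inv ≫ leftEv V ▷ Y ≫ (λ_ Y).hom)
    (fun {X Y} f => by
      simp only [tensor_whiskerLeft, Category.assoc, Iso.inv_hom_id_assoc]
      rw [← whiskerLeft_comp_assoc, ht, whiskerLeft_comp_assoc,
        associator_inv_naturality_right_assoc,
        whisker_exchange_assoc]
      simp)
  refine ⟨(λ_ W).inv ≫ leftCoev V ▷ W ≫ (α_ _ _ _).hom ≫ V ◁ g, fun Y => ?_⟩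
  calc
    _ = (λ_ W).inv ▷ Y ≫ leftCoev V ▷ W ▷ Y ⊗≫ V ◁ (g ▷ Y ≫ a Y) := by monoidal
    _ = 𝟙 _ ⊗≫ (leftCoev V ▷ (W ⊗ Y) ≫ (V ⊗ Vᘁ) ◁ t Y) ⊗≫ V ◁ leftEv V ▷ Y ⊗≫ 𝟙 _ := by
      rw [hg]; monoidal
    _ = 𝟙 _ ⊗≫ t Y ⊗≫ (leftCoev V ▷ V ⊗≫ V ◁ leftEv V) ▷ Y ⊗≫ 𝟙 _ := by
      rw [← whisker_exchange]; monoidal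
    _ = _ := by
      rw [show leftCoev V ▷ V ⊗≫ V ◁ leftEv V = ⊗𝟙.hom from
        ExactPairing.evaluation_coevaluation'' V Vᘁ]
      monoidal

lemma IsFaithfulAction.left_ext {κ : Type*} {N : C} {Y Y' : κ → C} {b : ∀ i, N ⊗ Y i ⟶ Y' i}
    (hb : IsFaithfulAction b) {W V : C} {s t : W ⟶ V ⊗ N}
    (hst : ∀ j, s ▷ Y j ≫ (α_ _ _ _).hom ≫ V ◁ b j = t ▷ Y j ≫ (α_ _ _ _).hom ≫ V ◁ b j) :
    s = t := by
  let V' : C := Vᘁ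
  let : ExactPairing V V' := inferInstanceAs (ExactPairing V (Vᘁ : C))
  refine (tensorLeftHomEquiv W V V' N).symm.injective (hb fun j => ?_)
  have key : ∀ s : W ⟶ V ⊗ N, (tensorLeftHomEquiv W V V' N).symm s ▷ Y j ≫ b j =
      (α_ _ _ _).hom ≫ V' ◁ (s ▷ Y j ≫ (α_ _ _ _).hom ≫ V ◁ b j) ≫ (α_ _ _ _).inv ≫
        ε_ V V' ▷ Y' j ≫ (λ_ _).hom := fun s => by
    calc
      _ = (V' ◁ s) ▷ Y j ⊗≫ (ε_ V V' ▷ (N ⊗ Y j) ≫ 𝟙_ C ◁ b j) ⊗≫ 𝟙 _ := by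
        simp only [tensorLeftHomEquiv, Equiv.coe_fn_symm_mk]; monoidal
      _ = _ := by rw [← whisker_exchange]; monoidal
  rw [key, key, hst]

variable [BraidedCategory C]

/-- Again `V` is bent to the source, but here `X i` must cross `V` to reach `M`. Sliding the
evaluation past `X i` shows that the extra braiding does not lose information. -/
lemma IsFaithfulAction.right_ext {ι : Type*} {M : C} {X X' : ι → C} {a : ∀ i, M ⊗ X i ⟶ X' i}
    (ha : IsFaithfulAction a) {W V : C} {s t : W ⟶ M ⊗ V}
    (hst : ∀ i, s ▷ X i ≫ (α_ _ _ _).hom ≫ M ◁ (β_ V (X i)).hom ≫ (α_ _ _ _).inv ≫ a i ▷ V =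
      t ▷ X i ≫ (α_ _ _ _).hom ≫ M ◁ (β_ V (X i)).hom ≫ (α_ _ _ _).inv ≫ a i ▷ V) : s = t := by
  let V' : C := ᘁV
  let : ExactPairing V' V := inferInstanceAs (ExactPairing (ᘁV) V)
  refine (tensorRightHomEquiv W V' V M).symm.injective (ha fun i => ?_)
  have key : ∀ s : W ⟶ M ⊗ V, (tensorRightHomEquiv W V' V M).symm s ▷ X i ≫ a i =
      (α_ _ _ _).hom ≫ W ◁ (β_ V' (X i)).hom ≫ (α_ _ _ _).inv ≫
      (s ▷ X i ≫ (α_ _ _ _).hom ≫ M ◁ (β_ V (X i)).hom ≫ (α_ _ _ _).inv ≫ a i ▷ V) ▷ V' ≫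
        (α_ _ _ _).hom ≫ X' i ◁ ε_ V' V ≫ (ρ_ _).hom := fun s => by
    have slide : (ε_ V' V ▷ X i) ≫ (λ_ _).hom ≫ (ρ_ _).inv = (α_ _ _ _).hom ≫
        V ◁ (β_ V' (X i)).hom ≫ (α_ _ _ _).inv ≫ (β_ V (X i)).hom ▷ V' ≫ (α_ _ _ _).hom ≫
        X i ◁ ε_ V' V := by
      have := braiding_naturality_left (ε_ V' V) (X i)
      rw [braiding_tensor_left_hom, braiding_tensorUnit_left] at this
      rw [this]; simp
    calc
      _ = 𝟙 _ ⊗≫ s ▷ V' ▷ X i ⊗≫ M ◁ (ε_ V' V ▷ X i ≫ (λ_ _).hom ≫ (ρ_ _).inv) ⊗≫ a i := by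
        simp only [tensorRightHomEquiv, Equiv.coe_fn_symm_mk]; monoidal
      _ = 𝟙 _ ⊗≫ (s ▷ (V' ⊗ X i) ≫ (M ⊗ V) ◁ (β_ V' (X i)).hom) ⊗≫
           M ◁ (β_ V (X i)).hom ▷ V' ⊗≫ ((M ⊗ X i) ◁ ε_ V' V ≫ a i ▷ 𝟙_ C) ⊗≫ 𝟙 _ := by
        rw [slide]; monoidal
      _ = _ := by rw [← whisker_exchange s, whisker_exchange (a i)]; monoidal
  rw [key, key, hst]

/-- The braided counterpart of `exists_lift_left`: after bending `V`, its dual has to cross `X`, and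
this crossing is undone by `coev_braiding_slide`. -/
lemma IsUniversalAction.exists_lift_right {E : C} {a : ∀ X : C, E ⊗ X ⟶ X}
    (ha : IsUniversalAction a) {V Z : C} (u : ∀ X : C, Z ⊗ X ⟶ X ⊗ V)
    (hu : ∀ {X Y : C} (f : X ⟶ Y), Z ◁ f ≫ u Y = u X ≫ f ▷ V) :
    ∃ f : Z ⟶ E ⊗ V, ∀ X, f ▷ X ≫ (α_ _ _ _).hom ≫ E ◁ (β_ V X).hom ≫ (α_ _ _ _).inv ≫ a X ▷ V =
      u X := by
  let V' : C := ᘁV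
  let : ExactPairing V' V := inferInstanceAs (ExactPairing (ᘁV) V)
  obtain ⟨g, hg⟩ := ha.exists_lift
    (fun X => (α_ Z V' X).hom ≫ Z ◁ (β_ V' X).hom ≫ (α_ _ _ _).inv ≫ u X ▷ V' ≫
      (α_ _ _ _).hom ≫ X ◁ ε_ V' V ≫ (ρ_ X).hom)
    (fun {X Y} f => by
      simp only [tensor_whiskerLeft, Category.assoc, Iso.inv_hom_id_assoc]
      rw [← whiskerLeft_comp_assoc, braiding_naturality_right, whiskerLeft_comp_assoc,
        associator_inv_naturality_middle_assoc, ← comp_whiskerRight_assoc, hu,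
        comp_whiskerRight_assoc, associator_naturality_left_assoc, ← whisker_exchange_assoc]
      simp)
  refine ⟨(ρ_ Z).inv ≫ Z ◁ η_ V' V ≫ (α_ _ _ _).inv ≫ g ▷ V, fun X => ?_⟩
  calc
    _ = 𝟙 _ ⊗≫ Z ◁ η_ V' V ▷ X ⊗≫ (g ▷ (V ⊗ X) ≫ E ◁ (β_ V X).hom) ⊗≫ a X ▷ V := by monoidal
    _ = 𝟙 _ ⊗≫ Z ◁ η_ V' V ▷ X ⊗≫ Z ◁ V' ◁ (β_ V X).hom ⊗≫ (g ▷ X ≫ a X) ▷ V := by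
      rw [← whisker_exchange]; monoidal
    _ = 𝟙 _ ⊗≫ Z ◁ (η_ V' V ▷ X ≫ (α_ _ _ _).hom ≫ V' ◁ (β_ V X).hom ≫ (α_ _ X V).inv ≫
          (β_ V' X).hom ▷ V ≫ (α_ X V' V).hom) ⊗≫ u X ▷ V' ▷ V ⊗≫ X ◁ ε_ V' V ▷ V ⊗≫
          𝟙 _ := by
      rw [hg]; monoidal
    _ = 𝟙 _ ⊗≫ ((Z ⊗ X) ◁ η_ V' V ≫ u X ▷ (V' ⊗ V)) ⊗≫ X ◁ ε_ V' V ▷ V ⊗≫ 𝟙 _ := by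
      rw [coev_braiding_slide]; monoidal
    _ = 𝟙 _ ⊗≫ u X ⊗≫ X ◁ (V ◁ η_ V' V ⊗≫ ε_ V' V ▷ V) ⊗≫ 𝟙 _ := by
      rw [whisker_exchange]; monoidal
    _ = _ := by
      rw [ExactPairing.coevaluation_evaluation'']
      monoidal

/-- Faithfulness is tested one factor at a time: acting with `M` leaves a morphism into `X' i ⊗ N`,
which is then detected by the action of `N`. -/
lemma IsFaithfulAction.tensor {ι κ : Type*} {M N : C} {X X' : ι → C} {Y Y' : κ → C}
    {a : ∀ i, M ⊗ X i ⟶ X' i} {b : ∀ i, N ⊗ Y i ⟶ Y' i} (ha : IsFaithfulAction a)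
    (hb : IsFaithfulAction b) :
    IsFaithfulAction (ι := ι × κ) (X := fun p => X p.1 ⊗ Y p.2) (Y := fun p => X' p.1 ⊗ Y' p.2)
      (fun p => tensorμ M N (X p.1) (Y p.2) ≫ (a p.1 ⊗ₘ b p.2)) := by
  intro Z f g h
  refine ha.right_ext fun i => hb.left_ext fun j => ?_
  have key : ∀ f : Z ⟶ M ⊗ N, (f ▷ X i ≫ (α_ _ _ _).hom ≫ M ◁ (β_ N (X i)).hom ≫
      (α_ _ _ _).inv ≫ a i ▷ N) ▷ Y j ≫ (α_ _ _ _).hom ≫ X' i ◁ b j =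
      (α_ _ _ _).hom ≫ f ▷ (X i ⊗ Y j) ≫ tensorμ M N (X i) (Y j) ≫ (a i ⊗ₘ b j) := fun f => by
    rw [MonoidalCategory.tensorHom_def]; dsimp only [tensorμ]; monoidal
  rw [key, key, h (i, j)]

end Action

/-! ### Actions on tensor products -/

section TensorAction

variable {C : Type u} [Category.{v} C] [MonoidalCategory C] {E : C} (a : ∀ X : C, E ⊗ X ⟶ X)

/-- The action of `E` on the first factor of `X ⊗ Y`. -/
def actFst (X Y : C) : E ⊗ (X ⊗ Y) ⟶ X ⊗ Y := (α_ _ _ _).inv ≫ a X ▷ Y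

lemma actFst_naturality_right (X : C) {Y Y' : C} (g : Y ⟶ Y') :
    E ◁ X ◁ g ≫ actFst a X Y' = actFst a X Y ≫ X ◁ g := by
  simp only [actFst, Category.assoc]
  rw [← whisker_exchange]; simp

variable [BraidedCategory C]

/-- The action of `E` on the second factor of `X ⊗ Y`. -/
def actSnd (X Y : C) : E ⊗ (X ⊗ Y) ⟶ X ⊗ Y :=
  E ◁ (β_ Y X).inv ≫ actFst a Y X ≫ (β_ Y X).hom

/-- The action of `E ⊗ E` on `X ⊗ Y`. -/
def actTensor (X Y : C) : (E ⊗ E) ⊗ (X ⊗ Y) ⟶ X ⊗ Y :=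
  (α_ _ _ _).hom ≫ E ◁ actSnd a X Y ≫ actFst a X Y

/-- By naturality at `a Y` and a hexagon, conjugating by the braiding of `Y` with `X` amounts to
letting `E` cross `X`. -/
lemma actSnd_eq (X Y : C) :
    actSnd a X Y = (α_ _ _ _).inv ≫ (β_ E X).hom ▷ Y ≫ (α_ _ _ _).hom ≫ X ◁ a Y := by
  simp only [actSnd, actFst, Category.assoc]
  rw [braiding_naturality_left (a Y) X, braiding_tensor_left_hom]
  simp

lemma actSnd_naturality_left {X X' : C} (f : X ⟶ X')
    (Y : C) : E ◁ f ▷ Y ≫ actSnd a X' Y = actSnd a X Y ≫ f ▷ Y := by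
  simp only [actSnd, Category.assoc]
  rw [← whiskerLeft_comp_assoc, braiding_inv_naturality_left, whiskerLeft_comp_assoc,
    reassoc_of% actFst_naturality_right, braiding_naturality_right]

lemma actTensor_eq (X Y : C) :
    actTensor a X Y = tensorμ E E X Y ≫ (a X ⊗ₘ a Y) := by
  rw [actTensor, actSnd_eq, actFst, MonoidalCategory.tensorHom_def, tensorμ]
  calc
    _ = 𝟙 _ ⊗≫ E ◁ (β_ E X).hom ▷ Y ⊗≫ ((E ⊗ X) ◁ a Y ≫ a X ▷ Y) := by monoidal
    _ = _ := by rw [whisker_exchange]; monoidal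

lemma tensorHom_whiskerRight_actTensor {M N : C} (f : M ⟶ E) (g : N ⟶ E) (X Y : C) :
    (f ⊗ₘ g) ▷ (X ⊗ Y) ≫ actTensor a X Y =
      tensorμ M N X Y ≫ ((f ▷ X ≫ a X) ⊗ₘ (g ▷ Y ≫ a Y)) := by
  rw [actTensor_eq, tensorμ_natural_left_assoc, tensorHom_comp_tensorHom]

/-- Braiding the two acting factors exchanges the order of the actions. -/
lemma braiding_actTensor (X Y : C) :
    (β_ E E).hom ▷ (X ⊗ Y) ≫ actTensor a X Y =
      (α_ _ _ _).hom ≫ E ◁ actFst a X Y ≫ actSnd a X Y := by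
  rw [actTensor, actSnd_eq, actFst]
  calc
    _ = 𝟙 _ ⊗≫ (β_ E E).hom ▷ X ▷ Y ⊗≫ E ◁ (β_ E X).hom ▷ Y ⊗≫
          ((E ⊗ X) ◁ a Y ≫ a X ▷ Y) := by monoidal
    _ = 𝟙 _ ⊗≫ ((α_ E E X).inv ≫ (β_ E E).hom ▷ X ≫ (α_ E E X).hom ≫ E ◁ (β_ E X).hom ≫
          (α_ E X E).inv) ▷ Y ⊗≫ (a X ▷ (E ⊗ Y) ≫ X ◁ a Y) ⊗≫ 𝟙 _ := by
      rw [whisker_exchange]; monoidal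
    _ = 𝟙 _ ⊗≫ ((β_ E (E ⊗ X)).hom ≫ a X ▷ E) ▷ Y ⊗≫ X ◁ a Y := by
      rw [braiding_tensor_right_hom]; monoidal
    _ = _ := by rw [← braiding_naturality_right]; monoidal

variable {a}

/-- The form in which identities between morphisms into `E ⊗ E` are checked below. -/
lemma IsUniversalAction.hom_ext₂ [RigidCategory C] (ha : IsUniversalAction a) {Z : C}
    {f g : Z ⟶ E ⊗ E}
    (h : ∀ X Y, f ▷ (X ⊗ Y) ≫ actTensor a X Y = g ▷ (X ⊗ Y) ≫ actTensor a X Y) : f = g :=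
  ha.isFaithfulAction.tensor ha.isFaithfulAction fun p => by
    simpa only [actTensor_eq] using h p.1 p.2

lemma IsUniversalAction.hom_ext_left [RigidCategory C] (ha : IsUniversalAction a) {Z : C}
    {f g : Z ⟶ (E ⊗ E) ⊗ E}
    (h : ∀ X Y T, f ▷ ((X ⊗ Y) ⊗ T) ≫ tensorμ _ _ _ _ ≫ (actTensor a X Y ⊗ₘ a T) =
      g ▷ ((X ⊗ Y) ⊗ T) ≫ tensorμ _ _ _ _ ≫ (actTensor a X Y ⊗ₘ a T)) : f = g :=
  (ha.isFaithfulAction.tensor ha.isFaithfulAction).tensor ha.isFaithfulAction fun p => by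
    simpa only [actTensor_eq] using h p.1.1 p.1.2 p.2

/-- Every family of endomorphisms of `X ⊗ Y` parametrized by `Z`, natural in `X` and `Y`, is given
by a morphism `Z ⟶ E ⊗ E`. -/
lemma IsUniversalAction.exists_lift₂ [RigidCategory C] (ha : IsUniversalAction a) {Z : C}
    (t : ∀ X Y : C, Z ⊗ (X ⊗ Y) ⟶ X ⊗ Y)
    (ht : ∀ {X Y X' Y' : C} (f : X ⟶ X') (g : Y ⟶ Y'),
      Z ◁ (f ⊗ₘ g) ≫ t X' Y' = t X Y ≫ (f ⊗ₘ g)) :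
    ∃ f : Z ⟶ E ⊗ E, ∀ X Y, f ▷ (X ⊗ Y) ≫ actTensor a X Y = t X Y := by
  have ht₁ : ∀ {X X' : C} (f : X ⟶ X') (Y : C), Z ◁ (f ▷ Y) ≫ t X' Y = t X Y ≫ f ▷ Y :=
    fun f Y => by simpa using ht f (𝟙 Y)
  have ht₂ : ∀ (X : C) {Y Y' : C} (g : Y ⟶ Y'), Z ◁ (X ◁ g) ≫ t X Y' = t X Y ≫ X ◁ g :=
    fun X _ _ g => by simpa using ht (𝟙 X) g
  -- Lift in `Y` first, with `X` fixed. Uniqueness of these lifts makes `u` natural in `X`, which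
  -- permits the second lift.
  choose u hu using fun X : C => ha.exists_lift_left (V := X) (W := Z ⊗ X)
    (fun Y => (α_ Z X Y).hom ≫ t X Y) (fun {Y Y'} g => by
      rw [tensor_whiskerLeft]; simp [ht₂])
  have hext : ∀ {W V : C} {s s' : W ⟶ V ⊗ E}, (∀ Y, s ▷ Y ≫ (α_ _ _ _).hom ≫ V ◁ a Y =
      s' ▷ Y ≫ (α_ _ _ _).hom ≫ V ◁ a Y) → s = s' := ha.isFaithfulAction.left_ext
  obtain ⟨f, hf⟩ := ha.exists_lift_right u fun {X X'} f => hext fun Y => by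
    have h : (u X ≫ f ▷ E) ▷ Y ≫ (α_ _ _ _).hom ≫ X' ◁ a Y =
        (u X ▷ Y ≫ (α_ _ _ _).hom ≫ X ◁ a Y) ≫ f ▷ Y := by
      simp only [comp_whiskerRight, Category.assoc, associator_naturality_left_assoc]
      rw [← whisker_exchange]
    rw [h, hu, comp_whiskerRight_assoc, hu]
    simp [ht₁]
  refine ⟨f, fun X Y => ?_⟩
  rw [actTensor, actSnd_eq, actFst]
  calc
    _ = 𝟙 _ ⊗≫ f ▷ X ▷ Y ⊗≫ E ◁ (β_ E X).hom ▷ Y ⊗≫ ((E ⊗ X) ◁ a Y ≫ a X ▷ Y) := by monoidal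
    _ = (α_ _ _ _).inv ≫ (f ▷ X ≫ (α_ _ _ _).hom ≫ E ◁ (β_ E X).hom ≫ (α_ _ _ _).inv ≫
          a X ▷ E) ▷ Y ≫ (α_ _ _ _).hom ≫ X ◁ a Y := by
      rw [whisker_exchange]; monoidal
    _ = _ := by rw [hf, hu]; simp

end TensorAction

/-! ### Structure morphisms described by their action -/

section ActionStructure

variable {C : Type u} [Category.{v} C] [MonoidalCategory C] [RigidCategory C] [BraidedCategory C]
  [RibbonCategory C] {E : C}

/-- The description of the product, unit, coproduct, counit, antipode, ribbon elements and
copairing of `E` through their action on the objects of the category. -/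
structure IsActionStructure (a : ∀ X : C, E ⊗ X ⟶ X) (D : BPRibbonData E) : Prop where
  mul : ∀ X, D.mul ▷ X ≫ a X = (α_ _ _ _).hom ≫ E ◁ a X ≫ a X
  one : ∀ X, D.one ▷ X ≫ a X = (λ_ X).hom
  comul : ∀ X Y, D.comul ▷ (X ⊗ Y) ≫ actTensor a X Y = a (X ⊗ Y)
  counit : a (𝟙_ C) = (ρ_ E).hom ≫ D.counit
  antipode : ∀ X, E ◁ leftCoev X ≫ D.antipode ▷ (X ⊗ Xᘁ) ≫ actFst a X Xᘁ =
    E ◁ leftCoev X ≫ actSnd a X Xᘁ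
  ribbon : ∀ X, D.ribbon ▷ X ≫ a X = (λ_ X).hom ≫ (twist X).inv
  ribbonInv : ∀ X, D.ribbonInv ▷ X ≫ a X = (λ_ X).hom ≫ (twist X).hom
  copairing : ∀ X Y, D.copairing ▷ (X ⊗ Y) ≫ actTensor a X Y =
    (λ_ _).hom ≫ (β_ Y X).inv ≫ (β_ X Y).inv

variable {a : ∀ X : C, E ⊗ X ⟶ X} {D : BPRibbonData E}

lemma RibbonCategory.twist_tensor_inv (X Y : C) :
    (twist (X ⊗ Y)).inv =
      (β_ Y X).inv ≫ (β_ X Y).inv ≫ ((twist X).inv ⊗ₘ (twist Y).inv) := by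
  have h : twist (X ⊗ Y) = β_ X Y ≪≫ β_ Y X ≪≫ (twist X ⊗ᵢ twist Y) :=
    Iso.ext (twist_tensor X Y)
  rw [h, Iso.trans_inv, Iso.trans_inv, tensorIso_inv, Category.assoc,
    braiding_inv_naturality_assoc, braiding_inv_naturality]

namespace IsActionStructure

lemma mul_actFst (hD : IsActionStructure a D) (X Y : C) :
    D.mul ▷ (X ⊗ Y) ≫ actFst a X Y = (α_ _ _ _).hom ≫ E ◁ actFst a X Y ≫ actFst a X Y := by
  calc
    _ = 𝟙 _ ⊗≫ (D.mul ▷ X ≫ a X) ▷ Y := by rw [actFst]; monoidal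
    _ = _ := by rw [hD.mul, actFst]; monoidal

lemma mul_actSnd (hD : IsActionStructure a D) (X Y : C) :
    D.mul ▷ (X ⊗ Y) ≫ actSnd a X Y = (α_ _ _ _).hom ≫ E ◁ actSnd a X Y ≫ actSnd a X Y := by
  rw [actSnd, ← whisker_exchange_assoc, reassoc_of% hD.mul_actFst]
  simp

/-- The coherence `tensor_associativity` of `tensorμ` makes the tensor product of two modules a
module over the braided tensor product algebra. -/
lemma mulTensor_actTensor (hD : IsActionStructure a D) (X Y : C) :
    D.mulTensor ▷ (X ⊗ Y) ≫ actTensor a X Y =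
      (α_ _ _ _).hom ≫ (E ⊗ E) ◁ actTensor a X Y ≫ actTensor a X Y := by
  rw [BPRibbonData.mulTensor, comp_whiskerRight_assoc, tensorHom_whiskerRight_actTensor, hD.mul,
    hD.mul, ← tensorHom_comp_tensorHom, tensor_associativity_assoc, ← tensorHom_comp_tensorHom,
    ← tensorμ_natural_right_assoc, actTensor_eq]
  simp

/-- The product is composition with the left factor acting last, so left multiplication puts `φ`
after the action and right multiplication puts it before. -/
lemma leftMul_act (hD : IsActionStructure a D) {p : 𝟙_ C ⟶ E} {X : C} {φ : X ⟶ X}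
    (h : p ▷ X ≫ a X = (λ_ X).hom ≫ φ) : D.leftMul p ▷ X ≫ a X = a X ≫ φ := by
  simp only [BPRibbonData.leftMul, comp_whiskerRight, Category.assoc, hD.mul]
  rw [associator_naturality_left_assoc, ← whisker_exchange_assoc, h]
  simp

lemma rightMul_act (hD : IsActionStructure a D) {p : 𝟙_ C ⟶ E} {X : C} {φ : X ⟶ X}
    (h : p ▷ X ≫ a X = (λ_ X).hom ≫ φ) : D.rightMul p ▷ X ≫ a X = E ◁ φ ≫ a X := by
  simp only [BPRibbonData.rightMul, comp_whiskerRight, Category.assoc, hD.mul]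
  rw [associator_naturality_middle_assoc, ← whiskerLeft_comp_assoc E (p ▷ X), h]
  simp

/-! #### The bialgebra axioms -/

lemma one_mul (ha : IsUniversalAction a) (hD : IsActionStructure a D) :
    D.one ▷ E ≫ D.mul = (λ_ E).hom := ha.hom_ext fun X => by
  simp only [comp_whiskerRight, Category.assoc, hD.mul]
  rw [associator_naturality_left_assoc, ← whisker_exchange_assoc, hD.one]
  simp

lemma mul_one (ha : IsUniversalAction a) (hD : IsActionStructure a D) :
    E ◁ D.one ≫ D.mul = (ρ_ E).hom := ha.hom_ext fun X => by
  simp only [comp_whiskerRight, Category.assoc, hD.mul]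
  rw [associator_naturality_middle_assoc, ← whiskerLeft_comp_assoc, hD.one]
  simp

lemma mul_associative (ha : IsUniversalAction a) (hD : IsActionStructure a D) :
    D.mul ▷ E ≫ D.mul = (α_ E E E).hom ≫ E ◁ D.mul ≫ D.mul :=
  ha.hom_ext fun X => by
    simp only [comp_whiskerRight, Category.assoc, hD.mul]
    rw [associator_naturality_left_assoc, ← whisker_exchange_assoc, hD.mul,
      associator_naturality_middle_assoc, ← whiskerLeft_comp_assoc, hD.mul]
    simp

lemma counit_whiskerRight_act (hD : IsActionStructure a D) (X : C) :
    D.counit ▷ E ▷ X ≫ (λ_ E).hom ▷ X ≫ a X =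
    (E ⊗ E) ◁ (λ_ X).inv ≫ actTensor a (𝟙_ C) X ≫ (λ_ X).hom := by
  rw [actTensor_eq, hD.counit, tensorμ, braiding_tensorUnit_right,
    MonoidalCategory.tensorHom_def]
  calc
    _ = 𝟙 _ ⊗≫ (D.counit ▷ (E ⊗ X) ≫ 𝟙_ C ◁ a X) ⊗≫ 𝟙 _ := by monoidal
    _ = _ := by monoidal

lemma counit_comul (ha : IsUniversalAction a) (hD : IsActionStructure a D) :
    D.comul ≫ D.counit ▷ E = (λ_ E).inv := by
  rw [← cancel_mono (λ_ E).hom, Iso.inv_hom_id]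
  refine ha.hom_ext fun X => ?_
  simp only [comp_whiskerRight, Category.assoc]
  rw [hD.counit_whiskerRight_act, ← whisker_exchange_assoc, reassoc_of% hD.comul,
    ← Category.assoc, ha.naturality]
  simp

lemma whiskerLeft_counit_act (hD : IsActionStructure a D) (X : C) :
    (E ◁ D.counit) ▷ X ≫ (ρ_ E).hom ▷ X ≫ a X =
    (E ⊗ E) ◁ (ρ_ X).inv ≫ actTensor a X (𝟙_ C) ≫ (ρ_ X).hom := by
  rw [actTensor_eq, hD.counit, tensorμ, MonoidalCategory.tensorHom_def']
  calc
    _ = 𝟙 _ ⊗≫ E ◁ (D.counit ▷ X ≫ (λ_ X).hom ≫ (ρ_ X).inv) ⊗≫ a X ⊗≫ 𝟙 _ := by monoidal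
    _ = 𝟙 _ ⊗≫ E ◁ (D.counit ▷ X ≫ (β_ (𝟙_ C) X).hom) ⊗≫ a X ⊗≫ 𝟙 _ := by
      rw [braiding_tensorUnit_left]
    _ = _ := by rw [braiding_naturality_left]; monoidal

lemma comul_counit (ha : IsUniversalAction a) (hD : IsActionStructure a D) :
    D.comul ≫ E ◁ D.counit = (ρ_ E).inv := by
  rw [← cancel_mono (ρ_ E).hom, Iso.inv_hom_id]
  refine ha.hom_ext fun X => ?_
  simp only [comp_whiskerRight, Category.assoc]
  rw [hD.whiskerLeft_counit_act, ← whisker_exchange_assoc, reassoc_of% hD.comul,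
    ← Category.assoc, ha.naturality]
  simp

lemma comul_act_left (hD : IsActionStructure a D) (X Y T : C) :
    (D.comul ▷ E) ▷ ((X ⊗ Y) ⊗ T) ≫ tensorμ _ _ _ _ ≫ (actTensor a X Y ⊗ₘ a T) =
      actTensor a (X ⊗ Y) T := by
  rw [← tensorHom_id D.comul, tensorμ_natural_left_assoc, tensorHom_comp_tensorHom, hD.comul,
    actTensor_eq]
  simp

lemma comul_act_right (hD : IsActionStructure a D) (X Y T : C) :
    (E ◁ D.comul ≫ (α_ E E E).inv) ▷ ((X ⊗ Y) ⊗ T) ≫ tensorμ _ _ _ _ ≫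
      (actTensor a X Y ⊗ₘ a T) =
      (E ⊗ E) ◁ (α_ X Y T).hom ≫ actTensor a X (Y ⊗ T) ≫ (α_ X Y T).inv := by
  -- Compatibility of `tensorμ` with associators: the threefold action does not depend on the
  -- bracketing.
  have key : tensorμ (E ⊗ E) E (X ⊗ Y) T ≫ (actTensor a X Y ⊗ₘ a T) =
      ((α_ E E E).hom ⊗ₘ (α_ X Y T).hom) ≫ tensorμ E (E ⊗ E) X (Y ⊗ T) ≫
        (a X ⊗ₘ actTensor a Y T) ≫ (α_ X Y T).inv := by
    have h := associator_monoidal E E E X Y T =≫ ((a X ⊗ₘ a Y ⊗ₘ a T) ≫ (α_ X Y T).inv)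
    simp only [Category.assoc] at h
    rw [actTensor_eq, actTensor_eq]
    calc
      _ = tensorμ (E ⊗ E) E (X ⊗ Y) T ≫ tensorμ E E X Y ▷ (E ⊗ T) ≫
          (α_ (E ⊗ X) (E ⊗ Y) (E ⊗ T)).hom ≫ (a X ⊗ₘ a Y ⊗ₘ a T) ≫ (α_ X Y T).inv := by
        rw [← associator_naturality_assoc, Iso.hom_inv_id, Category.comp_id]
        congr 1
        rw [← tensorHom_id, tensorHom_comp_tensorHom, Category.id_comp]
      _ = _ := by
        rw [h]
        congr 2
        rw [← Category.assoc]
        congr 1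
        rw [← id_tensorHom, tensorHom_comp_tensorHom, Category.id_comp]
  rw [key, ← tensorHom_id, tensorHom_comp_tensorHom_assoc, Category.assoc, Iso.inv_hom_id,
    Category.comp_id, Category.id_comp, MonoidalCategory.tensorHom_def', Category.assoc,
    ← id_tensorHom E, tensorμ_natural_left_assoc, tensorHom_comp_tensorHom_assoc, hD.comul,
    actTensor_eq]
  simp

/-- Both sides act through the action on a triple tensor product, and naturality at the associator
identifies the two bracketings. -/
lemma comul_coassociative (ha : IsUniversalAction a) (hD : IsActionStructure a D) :
    D.comul ≫ E ◁ D.comul = D.comul ≫ D.comul ▷ E ≫ (α_ E E E).hom := by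
  rw [← cancel_mono (α_ E E E).inv]
  refine ha.hom_ext_left fun X Y T => ?_
  simp only [Category.assoc, Iso.hom_inv_id, Category.comp_id]
  rw [comp_whiskerRight_assoc, hD.comul_act_right, comp_whiskerRight_assoc, hD.comul_act_left,
    hD.comul, ← whisker_exchange_assoc, reassoc_of% hD.comul, ← Category.assoc, ha.naturality]
  simp

lemma mul_comul (ha : IsUniversalAction a) (hD : IsActionStructure a D) :
    D.mul ≫ D.comul = (D.comul ⊗ₘ D.comul) ≫ D.mulTensor :=
  ha.hom_ext₂ fun X Y => by
    rw [comp_whiskerRight_assoc, hD.comul, hD.mul, comp_whiskerRight_assoc,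
      hD.mulTensor_actTensor, MonoidalCategory.tensorHom_def']
    simp only [comp_whiskerRight, Category.assoc]
    rw [associator_naturality_left_assoc, ← whisker_exchange_assoc, hD.comul,
      associator_naturality_middle_assoc, ← whiskerLeft_comp_assoc, hD.comul]

lemma one_comul (ha : IsUniversalAction a) (hD : IsActionStructure a D) :
    D.one ≫ D.comul = (λ_ _).inv ≫ (D.one ⊗ₘ D.one) :=
  ha.hom_ext₂ fun X Y => by
    rw [comp_whiskerRight_assoc, hD.comul, hD.one, comp_whiskerRight_assoc,
      tensorHom_whiskerRight_actTensor, hD.one, hD.one, tensor_left_unitality]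

lemma mul_counit (hD : IsActionStructure a D) :
    D.mul ≫ D.counit = (D.counit ⊗ₘ D.counit) ≫ (λ_ _).hom := by
  have h := hD.mul (𝟙_ C)
  rw [hD.counit] at h
  rw [← cancel_epi (ρ_ (E ⊗ E)).hom]
  calc
    _ = D.mul ▷ 𝟙_ C ≫ (ρ_ E).hom ≫ D.counit := by simp
    _ = _ := by rw [h, MonoidalCategory.tensorHom_def']; monoidal

lemma one_counit (hD : IsActionStructure a D) : D.one ≫ D.counit = 𝟙 (𝟙_ C) := by
  have h := hD.one (𝟙_ C)
  rw [hD.counit] at h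
  rw [← cancel_epi (ρ_ (𝟙_ C)).hom]
  simpa [unitors_equal] using h

/-! #### The ribbon elements and the copairing -/

/-- Naturality of the action at the inverse twist. -/
lemma ribbon_central (ha : IsUniversalAction a) (hD : IsActionStructure a D) :
    D.leftMul D.ribbon = D.rightMul D.ribbon := ha.hom_ext fun X => by
  rw [hD.leftMul_act (hD.ribbon X), hD.rightMul_act (hD.ribbon X), ha.naturality]

lemma ribbon_ribbonInv (ha : IsUniversalAction a) (hD : IsActionStructure a D) :
    D.ribbonInv ≫ D.leftMul D.ribbon = D.one := ha.hom_ext fun X => by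
  rw [comp_whiskerRight_assoc, hD.leftMul_act (hD.ribbon X), reassoc_of% hD.ribbonInv, hD.one]
  simp

lemma ribbonInv_ribbon (ha : IsUniversalAction a) (hD : IsActionStructure a D) :
    D.ribbon ≫ D.leftMul D.ribbonInv = D.one := ha.hom_ext fun X => by
  rw [comp_whiskerRight_assoc, hD.leftMul_act (hD.ribbonInv X), reassoc_of% hD.ribbon, hD.one]
  simp

lemma leftMul_ribbon_tensor_rightMul_ribbon
    (ha : IsUniversalAction a) (hD : IsActionStructure a D) (X Y : C) :
    (D.leftMul D.ribbon ⊗ₘ D.rightMul D.ribbon) ▷ (X ⊗ Y) ≫ actTensor a X Y =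
      actTensor a X Y ≫ ((twist X).inv ⊗ₘ (twist Y).inv) := by
  rw [tensorHom_whiskerRight_actTensor, hD.leftMul_act (hD.ribbon X),
    hD.rightMul_act (hD.ribbon Y), ha.naturality, ← tensorHom_comp_tensorHom, actTensor_eq,
    Category.assoc]

lemma leftMul_ribbonInv_tensor_rightMul_ribbonInv
    (ha : IsUniversalAction a) (hD : IsActionStructure a D) (X Y : C) :
    (D.leftMul D.ribbonInv ⊗ₘ D.rightMul D.ribbonInv) ▷ (X ⊗ Y) ≫ actTensor a X Y =
      actTensor a X Y ≫ ((twist X).hom ⊗ₘ (twist Y).hom) := by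
  rw [tensorHom_whiskerRight_actTensor, hD.leftMul_act (hD.ribbonInv X),
    hD.rightMul_act (hD.ribbonInv Y), ha.naturality, ← tensorHom_comp_tensorHom, actTensor_eq,
    Category.assoc]

/-- On `X ⊗ Y` the right-hand side acts by the inverse twist of `X ⊗ Y` followed by the twists of
`X` and `Y`, which leaves the inverse double braiding. -/
lemma copairing_eq (ha : IsUniversalAction a) (hD : IsActionStructure a D) : D.copairing =
    D.ribbon ≫ D.comul ≫ (D.leftMul D.ribbonInv ⊗ₘ D.rightMul D.ribbonInv) :=
  ha.hom_ext₂ fun X Y => by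
    simp only [comp_whiskerRight, Category.assoc]
    rw [hD.leftMul_ribbonInv_tensor_rightMul_ribbonInv ha, reassoc_of% hD.comul,
      reassoc_of% hD.ribbon,
      hD.copairing, twist_tensor_inv]
    simp

/-- Inserting `w₊` puts an inverse double braiding between the action on `Y` and the action on `X`.
Its two halves combine with the braidings hidden in `actSnd`, so that the factors act on `Y ⊗ X` in
the opposite order, which is what `braiding_actTensor` describes. -/
lemma innerCopairing_actTensor (hD : IsActionStructure a D) (X Y : C) :
    D.innerCopairing ▷ (X ⊗ Y) ≫ actTensor a X Y =
      (E ⊗ E) ◁ (β_ Y X).inv ≫ (β_ E E).hom ▷ _ ≫ actTensor a Y X ≫ (β_ X Y).inv := by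
  have hmul : (D.mul ⊗ₘ D.mul) ▷ (X ⊗ Y) ≫ actTensor a X Y =
      𝟙 _ ⊗≫ (E ⊗ E) ◁ (E ◁ actSnd a X Y ≫ actSnd a X Y) ⊗≫ E ◁ actFst a X Y ≫ actFst a X Y := by
    rw [MonoidalCategory.tensorHom_def', actTensor]
    calc
      _ = 𝟙 _ ⊗≫ (E ⊗ E) ◁ D.mul ▷ (X ⊗ Y) ⊗≫
          (D.mul ▷ (E ⊗ (X ⊗ Y)) ≫ E ◁ actSnd a X Y) ≫ actFst a X Y := by monoidal
      _ = 𝟙 _ ⊗≫ (E ⊗ E) ◁ (D.mul ▷ (X ⊗ Y) ≫ actSnd a X Y) ⊗≫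
          (D.mul ▷ (X ⊗ Y) ≫ actFst a X Y) := by
        rw [← whisker_exchange]; monoidal
      _ = _ := by rw [hD.mul_actFst, hD.mul_actSnd]; monoidal
  have hcop : D.copairing ▷ (X ⊗ Y) ≫ (α_ _ _ _).hom ≫ E ◁ actSnd a X Y ≫ actFst a X Y =
      (λ_ _).hom ≫ (β_ Y X).inv ≫ (β_ X Y).inv := hD.copairing X Y
  calc
    _ = 𝟙 _ ⊗≫ E ◁ D.copairing ▷ E ▷ (X ⊗ Y) ⊗≫
        ((D.mul ⊗ₘ D.mul) ▷ (X ⊗ Y) ≫ actTensor a X Y) := by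
      rw [BPRibbonData.innerCopairing, BPRibbonData.insertCopairing]; monoidal
    _ = 𝟙 _ ⊗≫ E ◁ (D.copairing ▷ (E ⊗ (X ⊗ Y)) ≫ (E ⊗ E) ◁ actSnd a X Y) ⊗≫
        E ◁ E ◁ actSnd a X Y ⊗≫ E ◁ actFst a X Y ≫ actFst a X Y := by
      rw [hmul]; monoidal
    _ = 𝟙 _ ⊗≫ E ◁ (𝟙_ C) ◁ actSnd a X Y ⊗≫ E ◁ (D.copairing ▷ (X ⊗ Y) ≫ (α_ _ _ _).hom ≫
          E ◁ actSnd a X Y ≫ actFst a X Y) ≫ actFst a X Y := by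
      rw [← whisker_exchange]; monoidal
    _ = 𝟙 _ ⊗≫ E ◁ (actSnd a X Y ≫ (β_ Y X).inv ≫ (β_ X Y).inv) ≫ actFst a X Y := by
      rw [hcop]; monoidal
    _ = 𝟙 _ ⊗≫ E ◁ E ◁ (β_ Y X).inv ⊗≫ E ◁ actFst a Y X ≫
          (E ◁ (β_ X Y).inv ≫ actFst a X Y ≫ (β_ X Y).hom) ≫ (β_ X Y).inv := by
      rw [actSnd]; simp [monoidalComp]
    _ = 𝟙 _ ⊗≫ E ◁ E ◁ (β_ Y X).inv ⊗≫ ((α_ _ _ _).hom ≫ E ◁ actFst a Y X ≫ actSnd a Y X) ≫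
          (β_ X Y).inv := by rw [actSnd]; simp [monoidalComp]
    _ = _ := by rw [← braiding_actTensor]; monoidal

lemma braiding_inv_innerCopairing_actTensor (hD : IsActionStructure a D) (X Y : C) :
    (β_ E E).inv ▷ (X ⊗ Y) ≫ D.innerCopairing ▷ (X ⊗ Y) ≫ actTensor a X Y =
      (E ⊗ E) ◁ (β_ Y X).inv ≫ actTensor a Y X ≫ (β_ X Y).inv := by
  rw [hD.innerCopairing_actTensor, ← whisker_exchange_assoc]
  simp

/-- After `c⁻¹` and the insertion of `w₊`, the coproduct acts on `Y ⊗ X` between two inverse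
braidings. Naturality of the action at a braiding brings it back to `X ⊗ Y`, and the formula for the
inverse twist of `X ⊗ Y` finishes. -/
lemma ribbon_comul (ha : IsUniversalAction a) (hD : IsActionStructure a D) :
    D.leftMul D.ribbon ≫ D.comul =
    D.comul ≫ (β_ E E).inv ≫ D.innerCopairing ≫ (D.leftMul D.ribbon ⊗ₘ D.rightMul D.ribbon) :=
  ha.hom_ext₂ fun X Y => by
    simp only [comp_whiskerRight, Category.assoc]
    rw [hD.comul, hD.leftMul_act (hD.ribbon _), hD.leftMul_ribbon_tensor_rightMul_ribbon ha,
      reassoc_of% hD.braiding_inv_innerCopairing_actTensor, ← whisker_exchange_assoc,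
      reassoc_of% hD.comul,
      ← Category.assoc, ha.naturality, twist_tensor_inv]
    simp

/-- Both sides act as `c(x ⊗ y)` with an inverse double braiding before and after. -/
lemma copairing_braiding (ha : IsUniversalAction a) (hD : IsActionStructure a D) :
    D.innerCopairing ≫ (β_ E E).inv ≫ D.innerCopairing =
    (β_ E E).hom ≫
      ((λ_ (E ⊗ E)).inv ≫ D.copairing ▷ (E ⊗ E) ≫ D.mulTensor) ≫
      ((ρ_ (E ⊗ E)).inv ≫ (E ⊗ E) ◁ D.copairing ≫ D.mulTensor) :=
  ha.hom_ext₂ fun X Y => by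
    have hl : ((λ_ (E ⊗ E)).inv ≫ D.copairing ▷ (E ⊗ E) ≫ D.mulTensor) ▷ (X ⊗ Y) ≫
        actTensor a X Y = actTensor a X Y ≫ (β_ Y X).inv ≫ (β_ X Y).inv := by
      simp only [comp_whiskerRight, Category.assoc, hD.mulTensor_actTensor]
      rw [associator_naturality_left_assoc, ← whisker_exchange_assoc, hD.copairing]
      simp
    have hr : ((ρ_ (E ⊗ E)).inv ≫ (E ⊗ E) ◁ D.copairing ≫ D.mulTensor) ▷ (X ⊗ Y) ≫
        actTensor a X Y = (E ⊗ E) ◁ ((β_ Y X).inv ≫ (β_ X Y).inv) ≫ actTensor a X Y := by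
      simp only [comp_whiskerRight, Category.assoc, hD.mulTensor_actTensor]
      rw [associator_naturality_middle_assoc, ← whiskerLeft_comp_assoc _ (D.copairing ▷ _),
        hD.copairing]
      calc
        _ = ((ρ_ (E ⊗ E)).inv ▷ (X ⊗ Y) ≫ (α_ (E ⊗ E) (𝟙_ C) (X ⊗ Y)).hom ≫
            (E ⊗ E) ◁ (λ_ (X ⊗ Y)).hom) ≫ (E ⊗ E) ◁ ((β_ Y X).inv ≫ (β_ X Y).inv) ≫
            actTensor a X Y := by simp only [MonoidalCategory.whiskerLeft_comp, Category.assoc]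
        _ = _ := by rw [triangle, inv_hom_whiskerRight, Category.id_comp]
    rw [comp_whiskerRight_assoc, comp_whiskerRight_assoc,
      hD.braiding_inv_innerCopairing_actTensor, ← whisker_exchange_assoc,
      reassoc_of% hD.innerCopairing_actTensor, comp_whiskerRight_assoc, comp_whiskerRight_assoc, hr,
      ← whisker_exchange_assoc, hl, ← whisker_exchange_assoc]
    simp

end IsActionStructure

end ActionStructure

/-! ### Duality, the twist and the antipode axioms -/

section ActionStructure

variable {C : Type u} [Category.{v} C] [MonoidalCategory C] [RigidCategory C]

lemma leftCoev_leftEv (X : C) : leftCoev X ▷ X ⊗≫ X ◁ leftEv X = ⊗𝟙.hom :=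
  ExactPairing.evaluation_coevaluation'' X Xᘁ

lemma leftEv_leftCoev (X : C) : Xᘁ ◁ leftCoev X ⊗≫ leftEv X ▷ Xᘁ = ⊗𝟙.hom :=
  ExactPairing.coevaluation_evaluation'' X Xᘁ

lemma eq_leftCoev_comp_leftEv {Z X : C} (φ : Z ⊗ X ⟶ X) :
    φ = 𝟙 _ ⊗≫ (Z ◁ leftCoev X ≫ (α_ _ _ _).inv ≫ φ ▷ Xᘁ) ▷ X ⊗≫ X ◁ leftEv X ⊗≫ 𝟙 _ := by
  calc
    _ = 𝟙 _ ⊗≫ Z ◁ (leftCoev X ▷ X ⊗≫ X ◁ leftEv X) ⊗≫ φ ⊗≫ 𝟙 _ := by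
      rw [leftCoev_leftEv]; monoidal
    _ = 𝟙 _ ⊗≫ Z ◁ leftCoev X ▷ X ⊗≫ ((Z ⊗ X) ◁ leftEv X ≫ φ ▷ 𝟙_ C) ⊗≫ 𝟙 _ := by monoidal
    _ = _ := by rw [whisker_exchange]; monoidal

lemma leftEv_cancel {Y X : C} {φ ψ : Y ⟶ X} (h : Xᘁ ◁ φ ≫ leftEv X = Xᘁ ◁ ψ ≫ leftEv X) :
    φ = ψ := by
  have key : ∀ φ : Y ⟶ X, φ = 𝟙 _ ⊗≫ leftCoev X ▷ Y ⊗≫ X ◁ (Xᘁ ◁ φ ≫ leftEv X) ⊗≫ 𝟙 _ := fun φ => by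
    calc
      _ = φ ⊗≫ (leftCoev X ▷ X ⊗≫ X ◁ leftEv X) ⊗≫ 𝟙 _ := by rw [leftCoev_leftEv]; monoidal
      _ = 𝟙 _ ⊗≫ (𝟙_ C ◁ φ ≫ leftCoev X ▷ X) ⊗≫ X ◁ leftEv X ⊗≫ 𝟙 _ := by monoidal
      _ = _ := by rw [whisker_exchange]; monoidal
  rw [key φ, h, ← key ψ]

variable {E : C} {a : ∀ X : C, E ⊗ X ⟶ X}

/-- An action on `X` is recovered from its effect on one leg of the coevaluation, which is where the
antipode is characterized. The evaluation version `hom_ext_leftEv` serves products with the antipode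
on the left. -/
lemma IsUniversalAction.hom_ext_leftCoev (ha : IsUniversalAction a) {Z : C} {f g : Z ⟶ E}
    (h : ∀ X, Z ◁ leftCoev X ≫ f ▷ (X ⊗ Xᘁ) ≫ actFst a X Xᘁ =
      Z ◁ leftCoev X ≫ g ▷ (X ⊗ Xᘁ) ≫ actFst a X Xᘁ) : f = g := by
  refine ha.hom_ext fun X => ?_
  have key : ∀ f : Z ⟶ E, Z ◁ leftCoev X ≫ (α_ _ _ _).inv ≫ (f ▷ X ≫ a X) ▷ Xᘁ =
      Z ◁ leftCoev X ≫ f ▷ (X ⊗ Xᘁ) ≫ actFst a X Xᘁ := fun f => by simp [actFst]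
  rw [eq_leftCoev_comp_leftEv (f ▷ X ≫ a X), eq_leftCoev_comp_leftEv (g ▷ X ≫ a X), key, key, h]

variable [BraidedCategory C]

lemma IsUniversalAction.hom_ext_leftEv (ha : IsUniversalAction a) {Z : C} {f g : Z ⟶ E}
    (h : ∀ X, f ▷ (Xᘁ ⊗ X) ≫ actSnd a Xᘁ X ≫ leftEv X =
      g ▷ (Xᘁ ⊗ X) ≫ actSnd a Xᘁ X ≫ leftEv X) : f = g := by
  refine ha.hom_ext fun X => leftEv_cancel ?_
  have key : ∀ f : Z ⟶ E, f ▷ (Xᘁ ⊗ X) ≫ actSnd a Xᘁ X ≫ leftEv X =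
      (α_ _ _ _).inv ≫ (β_ Z Xᘁ).hom ▷ X ≫ (α_ _ _ _).hom ≫ Xᘁ ◁ (f ▷ X ≫ a X) ≫ leftEv X :=
    fun f => by
      calc
        _ = (α_ _ _ _).inv ≫ (f ▷ Xᘁ ≫ (β_ E Xᘁ).hom) ▷ X ≫ (α_ _ _ _).hom ≫ Xᘁ ◁ a X ≫
            leftEv X := by rw [actSnd_eq]; monoidal
        _ = _ := by rw [braiding_naturality_left]; monoidal
  have := h X
  rw [key, key] at this
  simpa only [cancel_epi] using this

variable [RibbonCategory C] {D : BPRibbonData E}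

/-- The tensor formula on `𝟙_ C ⊗ 𝟙_ C` makes this twist idempotent, and it is invertible. -/
lemma RibbonCategory.twist_unit : (twist (𝟙_ C)).hom = 𝟙 _ := by
  have h₁ := twist_tensor (𝟙_ C) (𝟙_ C)
  have h₂ := twist_naturality (λ_ (𝟙_ C)).hom
  rw [h₁, braiding_tensorUnit_left, MonoidalCategory.tensorHom_def] at h₂
  have h₃ : (λ_ (𝟙_ C)).hom ≫ (twist (𝟙_ C)).hom =
      (λ_ (𝟙_ C)).hom ≫ (twist (𝟙_ C)).hom ≫ (twist (𝟙_ C)).hom := by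
    rw [h₂]; monoidal
  rw [cancel_epi] at h₃
  exact ((cancel_mono (twist (𝟙_ C)).hom).1 (by rw [Category.id_comp, ← h₃])).symm

lemma RibbonCategory.leftCoev_twist (X : C) :
    leftCoev X ≫ X ◁ (twist (Xᘁ)).hom = leftCoev X ≫ (twist X).hom ▷ Xᘁ := by
  rw [twist_dual, leftCoev_comp_rightAdjointMate]

lemma RibbonCategory.leftCoev_twist_inv (X : C) :
    leftCoev X ≫ X ◁ (twist (Xᘁ)).inv = leftCoev X ≫ (twist X).inv ▷ Xᘁ := by
  rw [← cancel_mono (X ◁ (twist (Xᘁ)).hom), Category.assoc, Category.assoc, ← whisker_exchange,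
    reassoc_of% leftCoev_twist]
  simp

namespace IsActionStructure

/-! #### The antipode -/

lemma one_actFst (hD : IsActionStructure a D) (X Y : C) :
    D.one ▷ (X ⊗ Y) ≫ actFst a X Y = (λ_ _).hom := by
  calc
    _ = 𝟙 _ ⊗≫ (D.one ▷ X ≫ a X) ▷ Y := by rw [actFst]; monoidal
    _ = _ := by rw [hD.one]; monoidal

lemma one_actSnd (hD : IsActionStructure a D) (X Y : C) :
    D.one ▷ (X ⊗ Y) ≫ actSnd a X Y = (λ_ _).hom := by
  rw [actSnd, ← whisker_exchange_assoc, ← Category.assoc (D.one ▷ _), hD.one_actFst]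
  simp

lemma ribbon_actSnd (hD : IsActionStructure a D) (X Y : C) :
    D.ribbon ▷ (X ⊗ Y) ≫ actSnd a X Y = (λ_ _).hom ≫ X ◁ (twist Y).inv := by
  have h : D.ribbon ▷ (Y ⊗ X) ≫ actFst a Y X = (λ_ _).hom ≫ (twist Y).inv ▷ X := by
    calc
      _ = 𝟙 _ ⊗≫ (D.ribbon ▷ Y ≫ a Y) ▷ X := by rw [actFst]; monoidal
      _ = _ := by rw [hD.ribbon]; monoidal
  rw [actSnd, ← whisker_exchange_assoc, reassoc_of% h, braiding_naturality_left]
  simp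

lemma antipode_act (hD : IsActionStructure a D) (X : C) :
    D.antipode ▷ X ≫ a X =
      𝟙 _ ⊗≫ (E ◁ leftCoev X ≫ actSnd a X Xᘁ) ▷ X ⊗≫ X ◁ leftEv X ⊗≫ 𝟙 _ := by
  have h : E ◁ leftCoev X ≫ (α_ _ _ _).inv ≫ (D.antipode ▷ X ≫ a X) ▷ Xᘁ =
      E ◁ leftCoev X ≫ D.antipode ▷ (X ⊗ Xᘁ) ≫ actFst a X Xᘁ := by simp [actFst]
  rw [eq_leftCoev_comp_leftEv (D.antipode ▷ X ≫ a X), h, hD.antipode]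

/-- The mirror image of the defining property of the antipode. Once `antipode_act` is inserted, `E`
crosses `Xᘁ ⊗ X` as a whole and slides past the evaluation; a zigzag remains. -/
lemma antipode_actSnd_leftEv (hD : IsActionStructure a D) (X : C) :
    D.antipode ▷ (Xᘁ ⊗ X) ≫ actSnd a (Xᘁ : C) X ≫ leftEv X = actFst a (Xᘁ : C) X ≫ leftEv X := by
  calc
    _ = 𝟙 _ ⊗≫ (D.antipode ▷ Xᘁ ≫ (β_ E (Xᘁ : C)).hom) ▷ X ⊗≫ (Xᘁ : C) ◁ a X ≫ leftEv X := by
      rw [actSnd_eq]; monoidal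
    _ = 𝟙 _ ⊗≫ (β_ E (Xᘁ : C)).hom ▷ X ⊗≫ (Xᘁ : C) ◁ (D.antipode ▷ X ≫ a X) ≫ leftEv X := by
      rw [braiding_naturality_left]; monoidal
    _ = 𝟙 _ ⊗≫ ((β_ E (Xᘁ : C)).hom ▷ 𝟙_ C ≫ ((Xᘁ : C) ⊗ E) ◁ leftCoev X) ▷ X ⊗≫
          (Xᘁ : C) ◁ (β_ E X).hom ▷ (Xᘁ : C) ▷ X ⊗≫ (Xᘁ : C) ◁ X ◁ a (Xᘁ : C) ▷ X ⊗≫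
          (((Xᘁ : C) ⊗ X) ◁ leftEv X ≫ leftEv X ▷ 𝟙_ C) ⊗≫ 𝟙 _ := by
      rw [hD.antipode_act, actSnd_eq]; monoidal
    _ = 𝟙 _ ⊗≫ E ◁ (Xᘁ : C) ◁ leftCoev X ▷ X ⊗≫
          ((α_ E (Xᘁ : C) X).inv ≫ (β_ E (Xᘁ : C)).hom ▷ X ≫ (α_ (Xᘁ : C) E X).hom ≫
          (Xᘁ : C) ◁ (β_ E X).hom ≫
            (α_ (Xᘁ : C) X E).inv) ▷ (Xᘁ : C) ▷ X ⊗≫ (((Xᘁ : C) ⊗ X) ◁ a (Xᘁ : C) ≫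
            leftEv X ▷ (Xᘁ : C)) ▷ X ⊗≫
          leftEv X := by
      rw [← whisker_exchange, whisker_exchange (leftEv X)]; monoidal
    _ = 𝟙 _ ⊗≫ E ◁ (Xᘁ : C) ◁ leftCoev X ▷ X ⊗≫
          ((β_ E (Xᘁ ⊗ X)).hom ≫ leftEv X ▷ E) ▷ (Xᘁ : C) ▷ X ⊗≫ a (Xᘁ : C) ▷ X ⊗≫ leftEv X := by
      rw [whisker_exchange, braiding_tensor_right_hom]; monoidal
    _ = 𝟙 _ ⊗≫ E ◁ ((Xᘁ : C) ◁ leftCoev X ⊗≫ leftEv X ▷ (Xᘁ : C)) ▷ X ⊗≫ a (Xᘁ : C) ▷ X ⊗≫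
          leftEv X := by
      rw [← braiding_naturality_right, braiding_tensorUnit_right]; monoidal
    _ = _ := by rw [leftEv_leftCoev, actFst]; monoidal

/-- Under the evaluation, `S` turns the last action on `X` into one on `Xᘁ`. The two parts of the
coproduct thus act together on `Xᘁ ⊗ X`, and naturality at the evaluation reduces this to the action
on `𝟙_ C`, the counit. -/
lemma antipode_left (ha : IsUniversalAction a) (hD : IsActionStructure a D) :
    D.comul ≫ D.antipode ▷ E ≫ D.mul = D.counit ≫ D.one := by
  refine ha.hom_ext_leftEv fun X => ?_
  calc
    _ = D.comul ▷ (Xᘁ ⊗ X) ≫ (D.antipode ▷ E) ▷ (Xᘁ ⊗ X) ≫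
        (D.mul ▷ (Xᘁ ⊗ X) ≫ actSnd a Xᘁ X) ≫ leftEv X := by simp
    _ = D.comul ▷ (Xᘁ ⊗ X) ≫ (α_ _ _ _).hom ≫ (D.antipode ▷ (E ⊗ (Xᘁ ⊗ X)) ≫
        E ◁ actSnd a Xᘁ X) ≫ actSnd a Xᘁ X ≫ leftEv X := by rw [hD.mul_actSnd]; simp
    _ = (D.comul ▷ (Xᘁ ⊗ X) ≫ actTensor a Xᘁ X) ≫ leftEv X := by
      rw [← whisker_exchange, Category.assoc, hD.antipode_actSnd_leftEv, actTensor]; simp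
    _ = E ◁ leftEv X ≫ (ρ_ E).hom ≫ D.counit := by
      rw [hD.comul, ← ha.naturality, hD.counit]
    _ = D.counit ▷ (Xᘁ ⊗ X) ≫ (D.one ▷ (Xᘁ ⊗ X) ≫ actSnd a Xᘁ X) ≫ leftEv X := by
      rw [hD.one_actSnd, ← leftUnitor_naturality, ← whisker_exchange_assoc]
      simp [unitors_equal]
    _ = _ := by simp

lemma antipode_right (ha : IsUniversalAction a) (hD : IsActionStructure a D) :
    D.comul ≫ E ◁ D.antipode ≫ D.mul = D.counit ≫ D.one := by
  refine ha.hom_ext_leftCoev fun X => ?_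
  calc
    _ = E ◁ leftCoev X ≫ D.comul ▷ (X ⊗ Xᘁ) ≫ (E ◁ D.antipode) ▷ (X ⊗ Xᘁ) ≫
        (D.mul ▷ (X ⊗ Xᘁ) ≫ actFst a X Xᘁ) := by simp
    _ = D.comul ▷ (𝟙_ C) ≫ (α_ _ _ _).hom ≫ E ◁ (E ◁ leftCoev X ≫ D.antipode ▷ (X ⊗ Xᘁ) ≫
        actFst a X Xᘁ) ≫ actFst a X Xᘁ := by
      rw [hD.mul_actFst, whisker_exchange_assoc]; simp
    _ = E ◁ leftCoev X ≫ (D.comul ▷ (X ⊗ Xᘁ) ≫ actTensor a X Xᘁ) := by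
      rw [hD.antipode, actTensor, whisker_exchange_assoc]; simp
    _ = (ρ_ E).hom ≫ D.counit ≫ leftCoev X := by
      rw [hD.comul, ha.naturality, hD.counit, Category.assoc]
    _ = E ◁ leftCoev X ≫ D.counit ▷ (X ⊗ Xᘁ) ≫ (D.one ▷ (X ⊗ Xᘁ) ≫ actFst a X Xᘁ) := by
      rw [hD.one_actFst, whisker_exchange_assoc]
      simp [unitors_equal]
    _ = _ := by simp

/-- `twist_dual` moves the inverse twist from one leg of the coevaluation to the other. -/
lemma ribbon_antipode (ha : IsUniversalAction a) (hD : IsActionStructure a D) :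
    D.ribbon ≫ D.antipode = D.ribbon := by
  refine ha.hom_ext_leftCoev fun X => ?_
  calc
    _ = D.ribbon ▷ 𝟙_ C ≫ E ◁ leftCoev X ≫ D.antipode ▷ (X ⊗ Xᘁ) ≫ actFst a X Xᘁ := by
      rw [← whisker_exchange_assoc]; simp
    _ = 𝟙_ C ◁ leftCoev X ≫ D.ribbon ▷ (X ⊗ Xᘁ) ≫ actSnd a X Xᘁ := by
      rw [hD.antipode, whisker_exchange_assoc]
    _ = 𝟙_ C ◁ leftCoev X ≫ (λ_ _).hom ≫ (twist X).inv ▷ Xᘁ := by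
      rw [hD.ribbon_actSnd, leftUnitor_naturality_assoc, leftUnitor_naturality_assoc,
        leftCoev_twist_inv]
    _ = 𝟙_ C ◁ leftCoev X ≫ (α_ _ _ _).inv ≫ (D.ribbon ▷ X ≫ a X) ▷ Xᘁ := by
      rw [hD.ribbon]; simp
    _ = _ := by rw [actFst]; simp

lemma ribbon_counit (hD : IsActionStructure a D) : D.ribbon ≫ D.counit = 𝟙 (𝟙_ C) := by
  have h := hD.ribbon (𝟙_ C)
  have h' : (twist (𝟙_ C)).inv = 𝟙 _ := by
    rw [← cancel_epi (twist (𝟙_ C)).hom, Iso.hom_inv_id, twist_unit, Category.comp_id]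
  rw [hD.counit, h'] at h
  rw [← cancel_epi (ρ_ (𝟙_ C)).hom]
  simpa [unitors_equal] using h

/-! #### The Hopf copairing -/

lemma copairing_counit_left (ha : IsUniversalAction a) (hD : IsActionStructure a D) :
    D.copairing ≫ D.counit ▷ E ≫ (λ_ E).hom = D.one := ha.hom_ext fun X => by
  simp only [comp_whiskerRight, Category.assoc]
  rw [hD.counit_whiskerRight_act, ← whisker_exchange_assoc, reassoc_of% hD.copairing, hD.one]
  simp

lemma copairing_counit_right (ha : IsUniversalAction a) (hD : IsActionStructure a D) :
    D.copairing ≫ E ◁ D.counit ≫ (ρ_ E).hom = D.one := ha.hom_ext fun X => by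
  simp only [comp_whiskerRight, Category.assoc]
  rw [hD.whiskerLeft_counit_act, ← whisker_exchange_assoc, reassoc_of% hD.copairing, hD.one]
  simp only [braiding_inv_tensorUnit_left, braiding_inv_tensorUnit_right]
  monoidal

end IsActionStructure

end ActionStructure

/-! ### The copairing and the hexagons on triple tensor products -/

section TripleAction

variable {C : Type u} [Category.{v} C] [MonoidalCategory C] [BraidedCategory C]
  {E : C} (a : ∀ X : C, E ⊗ X ⟶ X)

lemma tensorμ_actTensor_eq (X Y T : C) :
    tensorμ (E ⊗ E) E (X ⊗ Y) T ≫ (actTensor a X Y ⊗ₘ a T) =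
      𝟙 _ ⊗≫ (E ⊗ E) ◁ actSnd a (X ⊗ Y) T ⊗≫ E ◁ actSnd a X Y ▷ T ⊗≫ actFst a X Y ▷ T := by
  rw [MonoidalCategory.tensorHom_def', tensorμ, actSnd_eq a (X ⊗ Y), actTensor]
  monoidal

/-- The action on the third factor, obtained from the action on the second one. -/
lemma actSnd_tensor (X Y T : C) :
    actSnd a (X ⊗ Y) T =
      𝟙 _ ⊗≫ E ◁ X ◁ (β_ T Y).inv ⊗≫ actSnd a X T ▷ Y ⊗≫ X ◁ (β_ T Y).hom ⊗≫ 𝟙 _ := by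
  rw [actSnd, actSnd, braiding_tensor_right_hom, braiding_tensor_right_inv, actFst, actFst]
  monoidal

variable [RigidCategory C] [RibbonCategory C] {a} {D : BPRibbonData E}

namespace IsActionStructure

/-- The action of the copairing on the first and third factors. -/
lemma copairing_act_outer (hD : IsActionStructure a D) (X Y T : C) :
    D.copairing ▷ ((X ⊗ Y) ⊗ T) ⊗≫ E ◁ actSnd a (X ⊗ Y) T ⊗≫ actFst a X Y ▷ T =
      𝟙 _ ⊗≫ X ◁ (β_ T Y).inv ⊗≫ ((β_ T X).inv ≫ (β_ X T).inv) ▷ Y ⊗≫ X ◁ (β_ T Y).hom ⊗≫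
        𝟙 _ := by
  have h : D.copairing ▷ (X ⊗ T) ≫ (α_ _ _ _).hom ≫ E ◁ actSnd a X T ≫ actFst a X T =
      (λ_ _).hom ≫ (β_ T X).inv ≫ (β_ X T).inv := hD.copairing X T
  calc
    _ = 𝟙 _ ⊗≫ (D.copairing ▷ (X ⊗ (Y ⊗ T)) ≫ (E ⊗ E) ◁ X ◁ (β_ T Y).inv) ⊗≫
          E ◁ actSnd a X T ▷ Y ⊗≫ ((E ⊗ X) ◁ (β_ T Y).hom ≫ a X ▷ (Y ⊗ T)) ⊗≫ 𝟙 _ := by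
      rw [actSnd_tensor, actFst]; monoidal
    _ = 𝟙 _ ⊗≫ X ◁ (β_ T Y).inv ⊗≫ (D.copairing ▷ (X ⊗ T) ≫ (α_ _ _ _).hom ≫
          E ◁ actSnd a X T ≫ actFst a X T) ▷ Y ⊗≫ X ◁ (β_ T Y).hom ⊗≫ 𝟙 _ := by
      rw [← whisker_exchange, whisker_exchange (a X), actFst]; monoidal
    _ = _ := by rw [h]; monoidal

/-- The action of the copairing on the second and third factors. -/
lemma copairing_act_right (hD : IsActionStructure a D) (X Y T : C) :
    D.copairing ▷ ((X ⊗ Y) ⊗ T) ⊗≫ E ◁ actSnd a (X ⊗ Y) T ⊗≫ actSnd a X Y ▷ T =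
      𝟙 _ ⊗≫ X ◁ ((β_ T Y).inv ≫ (β_ Y T).inv) ⊗≫ 𝟙 _ := by
  have h : D.copairing ▷ (Y ⊗ T) ≫ (α_ _ _ _).hom ≫ E ◁ actSnd a Y T ≫ actFst a Y T =
      (λ_ _).hom ≫ (β_ T Y).inv ≫ (β_ Y T).inv := hD.copairing Y T
  calc
    _ = 𝟙 _ ⊗≫ D.copairing ▷ X ▷ (Y ⊗ T) ⊗≫ E ◁ (β_ E X).hom ▷ (Y ⊗ T) ⊗≫
          ((E ⊗ X) ◁ ((β_ E Y).hom ▷ T ⊗≫ Y ◁ a T) ≫ (β_ E X).hom ▷ (Y ⊗ T)) ⊗≫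
          X ◁ a Y ▷ T ⊗≫ 𝟙 _ := by
      rw [actSnd_eq, actSnd_eq, braiding_tensor_right_hom]; monoidal
    _ = 𝟙 _ ⊗≫ (D.copairing ▷ X ≫ (α_ _ _ _).hom ≫ E ◁ (β_ E X).hom ≫ (α_ _ _ _).inv ≫
          (β_ E X).hom ▷ E ≫ (α_ _ _ _).hom) ▷ (Y ⊗ T) ⊗≫
          X ◁ (E ◁ actSnd a Y T ≫ actFst a Y T) ⊗≫ 𝟙 _ := by
      rw [whisker_exchange, actSnd_eq a Y T, actFst]; monoidal
    _ = 𝟙 _ ⊗≫ X ◁ (D.copairing ▷ (Y ⊗ T) ≫ (α_ _ _ _).hom ≫ E ◁ actSnd a Y T ≫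
          actFst a Y T) ⊗≫ 𝟙 _ := by
      rw [coev_braiding_slide]; monoidal
    _ = _ := by rw [h]; monoidal

/-- The inverse double braiding of `X ⊗ Y` with `T` factors by the hexagons. On the other side the
inserted copy of `w₊` acts on `Y` and `T`, the original one on `X` and `T`; interchange separates
them. -/
lemma copairing_comul_left (ha : IsUniversalAction a) (hD : IsActionStructure a D) :
    D.copairing ≫ D.comul ▷ E =
      D.copairing ≫ D.insertCopairing ≫ E ◁ (α_ E E E).hom ≫ (α_ E E (E ⊗ E)).inv ≫
        (E ⊗ E) ◁ D.mul := by
  refine ha.hom_ext_left fun X Y T => ?_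
  rw [comp_whiskerRight_assoc, hD.comul_act_left, hD.copairing]
  symm
  calc
    _ = 𝟙 _ ⊗≫ D.copairing ▷ ((X ⊗ Y) ⊗ T) ⊗≫ E ◁ D.copairing ▷ E ▷ ((X ⊗ Y) ⊗ T) ⊗≫
          (E ⊗ E) ◁ (D.mul ▷ ((X ⊗ Y) ⊗ T) ≫ actSnd a (X ⊗ Y) T) ⊗≫ E ◁ actSnd a X Y ▷ T ⊗≫
          actFst a X Y ▷ T := by
      rw [tensorμ_actTensor_eq, BPRibbonData.insertCopairing]; monoidal
    _ = 𝟙 _ ⊗≫ D.copairing ▷ ((X ⊗ Y) ⊗ T) ⊗≫ E ◁ (D.copairing ▷ (E ⊗ ((X ⊗ Y) ⊗ T)) ≫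
          (E ⊗ E) ◁ actSnd a (X ⊗ Y) T) ⊗≫ E ◁ (E ◁ actSnd a (X ⊗ Y) T ⊗≫ actSnd a X Y ▷ T) ⊗≫
          actFst a X Y ▷ T := by
      rw [hD.mul_actSnd]; monoidal
    _ = 𝟙 _ ⊗≫ D.copairing ▷ ((X ⊗ Y) ⊗ T) ⊗≫ E ◁ actSnd a (X ⊗ Y) T ⊗≫
          E ◁ (D.copairing ▷ ((X ⊗ Y) ⊗ T) ⊗≫ E ◁ actSnd a (X ⊗ Y) T ⊗≫ actSnd a X Y ▷ T) ⊗≫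
          actFst a X Y ▷ T := by
      rw [← whisker_exchange]; monoidal
    _ = 𝟙 _ ⊗≫ D.copairing ▷ ((X ⊗ Y) ⊗ T) ⊗≫ E ◁ actSnd a (X ⊗ Y) T ⊗≫
          ((E ⊗ X) ◁ ((β_ T Y).inv ≫ (β_ Y T).inv) ≫ a X ▷ (Y ⊗ T)) ⊗≫ 𝟙 _ := by
      rw [hD.copairing_act_right, actFst]; monoidal
    _ = 𝟙 _ ⊗≫ (D.copairing ▷ ((X ⊗ Y) ⊗ T) ⊗≫ E ◁ actSnd a (X ⊗ Y) T ⊗≫ actFst a X Y ▷ T) ⊗≫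
          X ◁ ((β_ T Y).inv ≫ (β_ Y T).inv) ⊗≫ 𝟙 _ := by
      rw [whisker_exchange, actFst]; monoidal
    _ = 𝟙 _ ⊗≫ X ◁ (β_ T Y).inv ⊗≫ ((β_ T X).inv ≫ (β_ X T).inv) ▷ Y ⊗≫
          X ◁ ((β_ T Y).hom ≫ (β_ T Y).inv ≫ (β_ Y T).inv) ⊗≫ 𝟙 _ := by
      rw [hD.copairing_act_outer]; monoidal
    _ = _ := by
      rw [Iso.hom_inv_id_assoc, braiding_tensor_left_inv, braiding_tensor_right_inv]; monoidal

/-- As before, with the inserted copy acting on `X` and `Y`. It now acts before the outer copy, so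
naturality of the braiding is needed to move crossings of `X` and `Y` past `T` before the hexagon
for `Y ⊗ T` applies. -/
lemma copairing_comul_right (ha : IsUniversalAction a) (hD : IsActionStructure a D) :
    D.copairing ≫ E ◁ D.comul =
      D.copairing ≫ D.insertCopairing ≫ E ◁ (α_ E E E).hom ≫ (α_ E E (E ⊗ E)).inv ≫
        D.mul ▷ (E ⊗ E) := by
  rw [← cancel_mono (α_ E E E).inv]
  refine ha.hom_ext_left fun X Y T => ?_
  rw [Category.assoc, comp_whiskerRight_assoc, hD.comul_act_right, ← whisker_exchange_assoc,
    reassoc_of% hD.copairing]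
  have h : D.copairing ▷ (X ⊗ Y) ≫ (α_ _ _ _).hom ≫ E ◁ actSnd a X Y ≫ actFst a X Y =
      (λ_ _).hom ≫ (β_ Y X).inv ≫ (β_ X Y).inv := hD.copairing X Y
  symm
  calc
    _ = 𝟙 _ ⊗≫ D.copairing ▷ ((X ⊗ Y) ⊗ T) ⊗≫ E ◁ D.copairing ▷ E ▷ ((X ⊗ Y) ⊗ T) ⊗≫
          (D.mul ▷ (E ⊗ E ⊗ ((X ⊗ Y) ⊗ T)) ≫ E ◁ (E ◁ actSnd a (X ⊗ Y) T ⊗≫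
            actSnd a X Y ▷ T)) ⊗≫ actFst a X Y ▷ T := by
      rw [tensorμ_actTensor_eq, BPRibbonData.insertCopairing]; monoidal
    _ = 𝟙 _ ⊗≫ D.copairing ▷ ((X ⊗ Y) ⊗ T) ⊗≫ E ◁ (D.copairing ▷ (E ⊗ ((X ⊗ Y) ⊗ T)) ≫
          (E ⊗ E) ◁ actSnd a (X ⊗ Y) T) ⊗≫ (E ⊗ E) ◁ actSnd a X Y ▷ T ⊗≫
          (D.mul ▷ (X ⊗ Y) ≫ actFst a X Y) ▷ T := by
      rw [← whisker_exchange]; monoidal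
    _ = 𝟙 _ ⊗≫ D.copairing ▷ ((X ⊗ Y) ⊗ T) ⊗≫ E ◁ actSnd a (X ⊗ Y) T ⊗≫
          E ◁ (D.copairing ▷ (X ⊗ Y) ≫ (α_ _ _ _).hom ≫ E ◁ actSnd a X Y ≫ actFst a X Y) ▷ T ⊗≫
          actFst a X Y ▷ T := by
      rw [← whisker_exchange, hD.mul_actFst]; monoidal
    _ = 𝟙 _ ⊗≫ D.copairing ▷ ((X ⊗ Y) ⊗ T) ⊗≫
          E ◁ (actSnd a (X ⊗ Y) T ≫ ((β_ Y X).inv ≫ (β_ X Y).inv) ▷ T) ⊗≫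
          actFst a X Y ▷ T := by
      rw [h]; monoidal
    _ = 𝟙 _ ⊗≫ (D.copairing ▷ ((X ⊗ Y) ⊗ T) ≫ (E ⊗ E) ◁ ((β_ Y X).inv ≫ (β_ X Y).inv) ▷ T) ⊗≫
          E ◁ actSnd a (X ⊗ Y) T ⊗≫ actFst a X Y ▷ T := by
      rw [← actSnd_naturality_left]; monoidal
    _ = 𝟙 _ ⊗≫ ((β_ Y X).inv ≫ (β_ X Y).inv) ▷ T ⊗≫
          (D.copairing ▷ ((X ⊗ Y) ⊗ T) ⊗≫ E ◁ actSnd a (X ⊗ Y) T ⊗≫ actFst a X Y ▷ T) ⊗≫ 𝟙 _ := by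
      rw [← whisker_exchange]; monoidal
    _ = 𝟙 _ ⊗≫ ((β_ Y X).inv ≫ (β_ X Y).inv) ▷ T ⊗≫ X ◁ (β_ T Y).inv ⊗≫
          ((β_ T X).inv ≫ (β_ X T).inv) ▷ Y ⊗≫ X ◁ (β_ T Y).hom ⊗≫ 𝟙 _ := by
      rw [hD.copairing_act_outer]; monoidal
    _ = 𝟙 _ ⊗≫ (β_ Y X).inv ▷ T ⊗≫ ((β_ X Y).inv ▷ T ≫ (β_ T (X ⊗ Y)).inv) ⊗≫
          (β_ X T).inv ▷ Y ⊗≫ X ◁ (β_ T Y).hom ⊗≫ 𝟙 _ := by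
      rw [braiding_tensor_right_inv]; monoidal
    _ = 𝟙 _ ⊗≫ (β_ Y X).inv ▷ T ⊗≫ (β_ T (Y ⊗ X)).inv ⊗≫
          ((β_ X (T ⊗ Y)).inv ≫ X ◁ (β_ T Y).hom) ⊗≫ 𝟙 _ := by
      rw [braiding_inv_naturality_left, braiding_tensor_right_inv X]; monoidal
    _ = 𝟙 _ ⊗≫ (β_ Y X).inv ▷ T ⊗≫ Y ◁ (β_ T X).inv ⊗≫ ((β_ T Y).inv ≫ (β_ T Y).hom) ▷ X ⊗≫
          (β_ X (Y ⊗ T)).inv ⊗≫ 𝟙 _ := by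
      rw [← braiding_inv_naturality_left, braiding_tensor_right_inv T]; monoidal
    _ = _ := by rw [Iso.inv_hom_id, braiding_tensor_left_inv]; monoidal

end IsActionStructure

end TripleAction

/-! ### Pivotal structure -/

section Pivotal

variable {C : Type u} [Category.{v} C] [MonoidalCategory C] [RigidCategory C]

lemma leftCoev_cancel {X Y : C} {f g : Xᘁ ⟶ Y}
    (h : leftCoev X ≫ X ◁ f = leftCoev X ≫ X ◁ g) : f = g := by
  have key : ∀ f : (Xᘁ : C) ⟶ Y,
      f = 𝟙 _ ⊗≫ (Xᘁ : C) ◁ (leftCoev X ≫ X ◁ f) ⊗≫ leftEv X ▷ Y ⊗≫ 𝟙 _ := fun f => by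
    calc
      _ = 𝟙 _ ⊗≫ ((Xᘁ : C) ◁ leftCoev X ⊗≫ leftEv X ▷ (Xᘁ : C)) ⊗≫ f := by
        rw [leftEv_leftCoev]; monoidal
      _ = 𝟙 _ ⊗≫ (Xᘁ : C) ◁ leftCoev X ⊗≫ (leftEv X ▷ (Xᘁ : C) ≫ 𝟙_ C ◁ f) ⊗≫ 𝟙 _ := by monoidal
      _ = _ := by rw [← whisker_exchange]; monoidal
  rw [key f, h, ← key g]

variable [BraidedCategory C] [RibbonCategory C]

lemma leftCoev_dual_pivotalInv (X : C) :
    leftCoev (Xᘁ : C) ≫ (Xᘁ : C) ◁ pivotalInv X = rightCoev X := by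
  calc
    _ = 𝟙 _ ⊗≫ (leftCoev (Xᘁ : C) ▷ 𝟙_ C ≫ ((Xᘁ : C) ⊗ ((Xᘁ : C)ᘁ : C)) ◁ rightCoev X) ⊗≫
        (Xᘁ : C) ◁ leftEv (Xᘁ : C) ▷ X ⊗≫ 𝟙 _ := by
      rw [pivotalInv]; monoidal
    _ = 𝟙 _ ⊗≫ rightCoev X ⊗≫ (leftCoev (Xᘁ : C) ▷ (Xᘁ : C) ⊗≫
        (Xᘁ : C) ◁ leftEv (Xᘁ : C)) ▷ X ⊗≫ 𝟙 _ := by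
      rw [← whisker_exchange]; monoidal
    _ = _ := by rw [leftCoev_leftEv]; monoidal

/-- The coevaluation absorbs the twist of `X ⊗ Xᘁ`, by naturality and triviality of the twist on `𝟙_
C`. -/
lemma leftCoev_braiding_twist (X : C) :
    leftCoev X ≫ (β_ X (Xᘁ : C)).hom ≫ (β_ (Xᘁ : C) X).hom ≫
      ((twist X).hom ⊗ₘ (twist (Xᘁ : C)).hom) = leftCoev X := by
  rw [← twist_tensor, twist_naturality, twist_unit, Category.id_comp]

lemma rightCoev_braiding_twist (X : C) :
    rightCoev X ≫ (β_ (Xᘁ : C) X).hom ≫ (twist X).hom ▷ (Xᘁ : C) = leftCoev X := by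
  conv_rhs => rw [← leftCoev_braiding_twist X]
  rw [rightCoev, MonoidalCategory.tensorHom_def', ← braiding_naturality_left_assoc,
    ← braiding_naturality_right_assoc, reassoc_of% leftCoev_twist, braiding_naturality_left_assoc,
    Category.assoc, Category.assoc]

lemma rightCoev_dual_pivotalInv (X : C) :
    rightCoev (Xᘁ : C) ≫ pivotalInv X ▷ (Xᘁ : C) = leftCoev X := by
  rw [rightCoev, Category.assoc, Category.assoc, whisker_exchange,
    ← braiding_naturality_right_assoc, reassoc_of% leftCoev_dual_pivotalInv]
  conv_rhs => rw [← leftCoev_braiding_twist X]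
  rw [rightCoev, Category.assoc, Category.assoc, braiding_naturality_right_assoc,
    MonoidalCategory.tensorHom_def]

/-- Consistency of the identification of `X**` with `X` under duality; the antipode, which uses that
identification, needs it to be inverted. -/
lemma rightAdjointMate_pivotalInv (X : C) :
    (pivotalInv X)ᘁ ≫ pivotalInv (Xᘁ : C) = 𝟙 (Xᘁ : C) := by
  refine leftCoev_cancel ?_
  rw [MonoidalCategory.whiskerLeft_comp, reassoc_of% leftCoev_comp_rightAdjointMate,
    ← whisker_exchange, reassoc_of% leftCoev_dual_pivotalInv, rightCoev_dual_pivotalInv]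
  simp

lemma rightCoev_comp_rightAdjointMate {X Y : C} (f : X ⟶ Y) :
    rightCoev X ≫ (Xᘁ : C) ◁ f = rightCoev Y ≫ fᘁ ▷ Y := by
  simp only [rightCoev, Category.assoc]
  rw [← MonoidalCategory.whiskerLeft_comp, ← twist_naturality, MonoidalCategory.whiskerLeft_comp,
    ← braiding_naturality_left_assoc, ← reassoc_of% leftCoev_comp_rightAdjointMate,
    braiding_naturality_right_assoc, whisker_exchange]

lemma pivotalInv_naturality {X Y : C} (f : X ⟶ Y) :
    (fᘁ)ᘁ ≫ pivotalInv Y = pivotalInv X ≫ f := by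
  refine leftCoev_cancel ?_
  rw [MonoidalCategory.whiskerLeft_comp, reassoc_of% leftCoev_comp_rightAdjointMate,
    ← whisker_exchange, reassoc_of% leftCoev_dual_pivotalInv, MonoidalCategory.whiskerLeft_comp,
    reassoc_of% leftCoev_dual_pivotalInv, rightCoev_comp_rightAdjointMate]

end Pivotal

/-! ### The diagrammatic structure morphisms act as expected -/

section Diagrams

variable {C : Type u} [Category.{v} C] [MonoidalCategory C] [RigidCategory C]

lemma leftCoev_tensor_dualTensorIso (X Y : C) :
    leftCoev (X ⊗ Y) ≫ (X ⊗ Y) ◁ (dualTensorIso X Y).hom =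
      leftCoev X ⊗≫ X ◁ leftCoev Y ▷ (Xᘁ : C) ⊗≫ 𝟙 _ := by
  -- `dualTensorIso` is the mate of the identity when `Yᘁ ⊗ Xᘁ` is taken as a second dual of `X ⊗
  -- Y`; the explicit instance selects that dual.
  refine (@coevaluation_comp_rightAdjointMate C _ _ (X ⊗ Y) (X ⊗ Y)
    ⟨(Yᘁ : C) ⊗ (Xᘁ : C)⟩ _ (𝟙 _)).trans ?_
  rw [id_whiskerRight, Category.comp_id]
  refine (ExactPairing.tensor_coevaluation).trans ?_
  simp [leftCoev, monoidalComp]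

lemma dualTensorIso_leftEv (X Y : C) :
    (dualTensorIso X Y).hom ▷ (X ⊗ Y) ⊗≫ (Yᘁ : C) ◁ leftEv X ▷ Y ⊗≫ leftEv Y = leftEv (X ⊗ Y) := by
  have h : (dualTensorIso X Y).hom ▷ (X ⊗ Y) ≫ ε_ (X ⊗ Y) ((Yᘁ : C) ⊗ (Xᘁ : C)) =
      leftEv (X ⊗ Y) := by
    refine (@rightAdjointMate_comp_evaluation C _ _ (X ⊗ Y) (X ⊗ Y)
      ⟨(Yᘁ : C) ⊗ (Xᘁ : C)⟩ _ (𝟙 _)).trans ?_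
    rw [MonoidalCategory.whiskerLeft_id, Category.id_comp]
    rfl
  rw [← h, ExactPairing.tensor_evaluation, leftEv, leftEv]
  monoidal

/-- The contraction `X ⊗ X* ⊗ X ⟶ X`. -/
def leftCap (X : C) : (X ⊗ (Xᘁ : C)) ⊗ X ⟶ X := (α_ _ _ _).hom ≫ X ◁ leftEv X ≫ (ρ_ X).hom

lemma whiskerRight_leftCap {Z X : C} (f : Z ⟶ X ⊗ (Xᘁ : C)) :
    f ▷ X ≫ leftCap X = uncurryDual f := rfl

lemma isFaithfulAction_leftCap (X : C) :
    IsFaithfulAction (ι := Unit) (M := X ⊗ (Xᘁ : C)) (X := fun _ => X) (Y := fun _ => X)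
      (fun _ => leftCap X) :=
  fun _ _ _ h => uncurryDual_injective (h ())

/-- The family `E ⟶ X ⊗ X*` adjoint to an action. -/
lemma leftCoev_actFst_uncurryDual {E : C} (j : ∀ X : C, E ⟶ X ⊗ (Xᘁ : C)) (X : C) :
    E ◁ leftCoev X ≫ actFst (fun X => uncurryDual (j X)) X (Xᘁ : C) = (ρ_ E).hom ≫ j X := by
  calc
    _ = 𝟙 _ ⊗≫ (E ◁ leftCoev X ≫ j X ▷ (X ⊗ (Xᘁ : C))) ⊗≫ X ◁ leftEv X ▷ (Xᘁ : C) ⊗≫ 𝟙 _ := by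
      rw [actFst, uncurryDual_eq]; monoidal
    _ = 𝟙 _ ⊗≫ j X ⊗≫ X ◁ ((Xᘁ : C) ◁ leftCoev X ⊗≫ leftEv X ▷ (Xᘁ : C)) ⊗≫ 𝟙 _ := by
      rw [whisker_exchange]; monoidal
    _ = _ := by rw [leftEv_leftCoev]; monoidal

lemma uncurryDual_mul_diagram {E : C} (j : ∀ X : C, E ⟶ X ⊗ (Xᘁ : C)) (X : C) :
    uncurryDual ((j X ⊗ₘ j X) ⊗≫ X ◁ (leftEv X ▷ (Xᘁ : C)) ⊗≫ 𝟙 (X ⊗ (Xᘁ : C))) =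
      (α_ _ _ _).hom ≫ E ◁ uncurryDual (j X) ≫ uncurryDual (j X) := by
  rw [MonoidalCategory.tensorHom_def', uncurryDual_eq, uncurryDual_eq]
  calc
    _ = 𝟙 _ ⊗≫ E ◁ j X ▷ X ⊗≫ j X ▷ ((X ⊗ (Xᘁ : C)) ⊗ X) ⊗≫
          X ◁ (leftEv X ▷ ((Xᘁ : C) ⊗ X) ≫ 𝟙_ C ◁ leftEv X) ⊗≫ 𝟙 _ := by monoidal
    _ = 𝟙 _ ⊗≫ E ◁ j X ▷ X ⊗≫ (j X ▷ (X ⊗ (Xᘁ : C) ⊗ X) ≫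
          (X ⊗ (Xᘁ : C)) ◁ X ◁ leftEv X) ⊗≫ X ◁ leftEv X ⊗≫ 𝟙 _ := by
      rw [← whisker_exchange]; monoidal
    _ = _ := by rw [← whisker_exchange]; monoidal

lemma uncurryDual_counit_diagram {E : C} (j : ∀ X : C, E ⟶ X ⊗ (Xᘁ : C)) :
    uncurryDual (j (𝟙_ C)) =
      (ρ_ E).hom ≫ j (𝟙_ C) ≫ (λ_ _).hom ≫ (ρ_ _).inv ≫ leftEv (𝟙_ C) := by
  rw [uncurryDual_eq]; monoidal

variable [BraidedCategory C]

/-- `X ⊗ Xᘁ` acts faithfully on the single object `X`, so `IsFaithfulAction.tensor` applies to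
one-element families. -/
lemma hom_ext_leftCap {Z X Y : C} {f g : Z ⟶ (X ⊗ (Xᘁ : C)) ⊗ (Y ⊗ (Yᘁ : C))}
    (h : f ▷ (X ⊗ Y) ≫ tensorμ _ _ X Y ≫ (leftCap X ⊗ₘ leftCap Y) =
      g ▷ (X ⊗ Y) ≫ tensorμ _ _ X Y ≫ (leftCap X ⊗ₘ leftCap Y)) : f = g :=
  (isFaithfulAction_leftCap X).tensor (isFaithfulAction_leftCap Y) fun _ => h

lemma tensorHom_leftCap {E : C} (j : ∀ X : C, E ⟶ X ⊗ (Xᘁ : C)) (X Y : C) :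
    (j X ⊗ₘ j Y) ▷ (X ⊗ Y) ≫ tensorμ _ _ X Y ≫ (leftCap X ⊗ₘ leftCap Y) =
      actTensor (fun X => uncurryDual (j X)) X Y := by
  rw [tensorμ_natural_left_assoc, tensorHom_comp_tensorHom, whiskerRight_leftCap,
    whiskerRight_leftCap, actTensor_eq]

/-- Moving `X*` to the left of `Y ⊗ Y*`. -/
def dualShuffle (X Y : C) :
    (X ⊗ Y) ⊗ ((Yᘁ : C) ⊗ (Xᘁ : C)) ⟶ (X ⊗ (Xᘁ : C)) ⊗ (Y ⊗ (Yᘁ : C)) :=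
  𝟙 _ ⊗≫ X ◁ (β_ (Y ⊗ (Yᘁ : C)) (Xᘁ : C)).hom ⊗≫ 𝟙 _

/-- The shuffle and `tensorμ` together carry `Y ⊗ Yᘁ` across `Xᘁ ⊗ X`, and this crossing disappears
at the evaluation. -/
lemma dualShuffle_leftCap (X Y : C) :
    dualShuffle X Y ▷ (X ⊗ Y) ≫ tensorμ _ _ X Y ≫ (leftCap X ⊗ₘ leftCap Y) =
      𝟙 _ ⊗≫ (X ⊗ Y) ◁ ((Yᘁ : C) ◁ leftEv X ▷ Y ⊗≫ leftEv Y) ⊗≫ 𝟙 _ := by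
  rw [MonoidalCategory.tensorHom_def, tensorμ, leftCap, leftCap, dualShuffle]
  calc
    _ = 𝟙 _ ⊗≫ X ◁ ((α_ _ _ _).inv ≫ (β_ (Y ⊗ (Yᘁ : C)) (Xᘁ : C)).hom ▷ X ≫ (α_ _ _ _).hom ≫
          (Xᘁ : C) ◁ (β_ (Y ⊗ (Yᘁ : C)) X).hom ≫ (α_ _ _ _).inv) ▷ Y ⊗≫
          X ◁ leftEv X ▷ (Y ⊗ (Yᘁ : C)) ▷ Y ⊗≫ X ◁ Y ◁ leftEv Y ⊗≫ 𝟙 _ := by monoidal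
    _ = 𝟙 _ ⊗≫ X ◁ ((β_ (Y ⊗ (Yᘁ : C)) ((Xᘁ : C) ⊗ X)).hom ≫
          leftEv X ▷ (Y ⊗ (Yᘁ : C))) ▷ Y ⊗≫ X ◁ Y ◁ leftEv Y ⊗≫ 𝟙 _ := by
      rw [braiding_tensor_right_hom]; monoidal
    _ = _ := by
      rw [← braiding_naturality_right, braiding_tensorUnit_right]; monoidal

/-- The morphism `E ⟶ (X ⊗ X*) ⊗ (Y ⊗ Y*)` that determines the coproduct. -/
lemma comul_diagram_leftCap {E : C} (j : ∀ X : C, E ⟶ X ⊗ (Xᘁ : C)) (X Y : C) :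
    (j (X ⊗ Y) ⊗≫ (X ⊗ Y) ◁ (dualTensorIso X Y).hom ⊗≫ X ◁ (β_ (Y ⊗ Yᘁ) (Xᘁ)).hom ⊗≫
      𝟙 ((X ⊗ Xᘁ) ⊗ (Y ⊗ Yᘁ))) ▷ (X ⊗ Y) ≫ tensorμ _ _ X Y ≫ (leftCap X ⊗ₘ leftCap Y) =
      uncurryDual (j (X ⊗ Y)) := by
  calc
    _ = (j (X ⊗ Y) ≫ (X ⊗ Y) ◁ (dualTensorIso X Y).hom) ▷ (X ⊗ Y) ≫
          dualShuffle X Y ▷ (X ⊗ Y) ≫ tensorμ _ _ X Y ≫ (leftCap X ⊗ₘ leftCap Y) := by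
      rw [dualShuffle]; monoidal
    _ = j (X ⊗ Y) ▷ (X ⊗ Y) ⊗≫ (X ⊗ Y) ◁ ((dualTensorIso X Y).hom ▷ (X ⊗ Y) ⊗≫
          (Yᘁ : C) ◁ leftEv X ▷ Y ⊗≫ leftEv Y) ⊗≫ 𝟙 _ := by
      rw [dualShuffle_leftCap]; monoidal
    _ = _ := by rw [dualTensorIso_leftEv, uncurryDual_eq]; monoidal

/-- The inverse braiding in terms of the braiding with the dual. -/
lemma leftCoev_braiding_leftEv (X Y : C) :
    𝟙 _ ⊗≫ leftCoev X ▷ (Y ⊗ X) ⊗≫ X ◁ (β_ (Xᘁ : C) Y).hom ▷ X ⊗≫ (X ⊗ Y) ◁ leftEv X ⊗≫ 𝟙 _ =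
      (β_ X Y).inv := by
  have h : leftCoev X ▷ Y ≫ (α_ _ _ _).hom ≫ X ◁ (β_ (Xᘁ : C) Y).hom =
      (λ_ Y).hom ≫ (ρ_ Y).inv ≫ Y ◁ leftCoev X ≫ (α_ _ _ _).inv ≫
        (β_ X Y).inv ▷ (Xᘁ : C) ≫ (α_ _ _ _).hom := by
    have := coev_braiding_slide (leftCoev X) Y =≫
      ((α_ _ _ _).inv ≫ (β_ X Y).inv ▷ (Xᘁ : C) ≫ (α_ _ _ _).hom)
    simpa using this
  calc
    _ = 𝟙 _ ⊗≫ (leftCoev X ▷ Y ≫ (α_ _ _ _).hom ≫ X ◁ (β_ (Xᘁ : C) Y).hom) ▷ X ⊗≫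
          (X ⊗ Y) ◁ leftEv X ⊗≫ 𝟙 _ := by monoidal
    _ = 𝟙 _ ⊗≫ Y ◁ leftCoev X ▷ X ⊗≫ ((β_ X Y).inv ▷ ((Xᘁ : C) ⊗ X) ≫
          (X ⊗ Y) ◁ leftEv X) ⊗≫ 𝟙 _ := by rw [h]; monoidal
    _ = 𝟙 _ ⊗≫ Y ◁ (leftCoev X ▷ X ⊗≫ X ◁ leftEv X) ⊗≫ (β_ X Y).inv ⊗≫ 𝟙 _ := by
      rw [← whisker_exchange]; monoidal
    _ = _ := by rw [leftCoev_leftEv]; monoidal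

/-- The morphism `𝟙 ⟶ (X ⊗ X*) ⊗ (Y ⊗ Y*)` that determines the copairing. -/
lemma copairing_diagram_leftCap (X Y : C) :
    (𝟙 (𝟙_ C) ⊗≫ (leftCoev X ⊗ₘ leftCoev Y) ⊗≫
      X ◁ (((β_ (Xᘁ) Y).hom ≫ (β_ Y (Xᘁ)).hom) ▷ Yᘁ) ⊗≫ 𝟙 ((X ⊗ Xᘁ) ⊗ (Y ⊗ Yᘁ))) ▷ (X ⊗ Y) ≫
      tensorμ _ _ X Y ≫ (leftCap X ⊗ₘ leftCap Y) =
      (λ_ _).hom ≫ (β_ Y X).inv ≫ (β_ X Y).inv := by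
  rw [MonoidalCategory.tensorHom_def (leftCap X), tensorμ, leftCap, leftCap,
    braiding_tensor_left_hom]
  -- One crossing, of `Y` with `Xᘁ ⊗ X`, vanishes at the evaluation. The two that remain are inverse
  -- braidings by `leftCoev_braiding_leftEv`.
  calc
    _ = 𝟙 _ ⊗≫ (leftCoev X ⊗ₘ leftCoev Y) ▷ (X ⊗ Y) ⊗≫ X ◁ (β_ (Xᘁ : C) Y).hom ▷ (Yᘁ : C) ▷ X ▷ Y ⊗≫
          X ◁ ((β_ Y (Xᘁ : C)).hom ▷ ((Yᘁ : C) ⊗ X) ≫ ((Xᘁ : C) ⊗ Y) ◁ (β_ (Yᘁ : C) X).hom) ▷ Y ⊗≫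
          X ◁ (Xᘁ : C) ◁ (β_ Y X).hom ▷ (Yᘁ : C) ▷ Y ⊗≫
          X ◁ (leftEv X ▷ Y ▷ ((Yᘁ : C) ⊗ Y) ≫ (𝟙_ C ⊗ Y) ◁ leftEv Y) ⊗≫ 𝟙 _ := by monoidal
    _ = 𝟙 _ ⊗≫ (leftCoev X ⊗ₘ leftCoev Y) ▷ (X ⊗ Y) ⊗≫
          X ◁ ((β_ (Xᘁ : C) Y).hom ▷ ((Yᘁ : C) ⊗ X) ≫ (Y ⊗ (Xᘁ : C)) ◁ (β_ (Yᘁ : C) X).hom) ▷ Y ⊗≫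
          X ◁ ((α_ _ _ _).inv ≫ (β_ Y (Xᘁ : C)).hom ▷ X ≫ (α_ _ _ _).hom ≫
            (Xᘁ : C) ◁ (β_ Y X).hom ≫ (α_ _ _ _).inv) ▷ ((Yᘁ : C) ⊗ Y) ⊗≫
          (X ◁ leftEv X ▷ Y) ▷ ((Yᘁ : C) ⊗ Y) ⊗≫ (X ⊗ Y) ◁ leftEv Y ⊗≫ 𝟙 _ := by
      rw [← whisker_exchange]; monoidal
    _ = 𝟙 _ ⊗≫ (leftCoev X ⊗ₘ leftCoev Y) ▷ (X ⊗ Y) ⊗≫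
          X ◁ (((Xᘁ : C) ⊗ Y) ◁ (β_ (Yᘁ : C) X).hom ≫
            (β_ (Xᘁ : C) Y).hom ▷ (X ⊗ (Yᘁ : C))) ▷ Y ⊗≫
          X ◁ ((β_ Y ((Xᘁ : C) ⊗ X)).hom ≫ leftEv X ▷ Y) ▷ ((Yᘁ : C) ⊗ Y) ⊗≫
          (X ⊗ Y) ◁ leftEv Y ⊗≫ 𝟙 _ := by
      rw [← whisker_exchange, braiding_tensor_right_hom]; monoidal
    _ = 𝟙 _ ⊗≫ (leftCoev X ⊗ₘ leftCoev Y) ▷ (X ⊗ Y) ⊗≫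
          X ◁ (Xᘁ : C) ◁ Y ◁ (β_ (Yᘁ : C) X).hom ▷ Y ⊗≫
          ((X ◁ ((β_ (Xᘁ : C) Y).hom ▷ X ⊗≫ Y ◁ leftEv X)) ▷ ((Yᘁ : C) ⊗ Y) ≫
          (X ⊗ Y ⊗ 𝟙_ C) ◁ leftEv Y) ⊗≫ 𝟙 _ := by
      rw [← braiding_naturality_right, braiding_tensorUnit_right]; monoidal
    _ = 𝟙 _ ⊗≫ (leftCoev X ▷ (X ⊗ Y) ≫ (X ⊗ (Xᘁ : C)) ◁ (𝟙 (X ⊗ Y) ⊗≫ leftCoev Y ▷ (X ⊗ Y) ⊗≫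
            Y ◁ (β_ (Yᘁ : C) X).hom ▷ Y ⊗≫ (Y ⊗ X) ◁ leftEv Y ⊗≫ 𝟙 (Y ⊗ X))) ⊗≫
          X ◁ ((β_ (Xᘁ : C) Y).hom ▷ X ⊗≫ Y ◁ leftEv X) ⊗≫ 𝟙 _ := by
      rw [← whisker_exchange, MonoidalCategory.tensorHom_def]; monoidal
    _ = 𝟙 _ ⊗≫ (β_ Y X).inv ⊗≫ (𝟙 (Y ⊗ X) ⊗≫ leftCoev X ▷ (Y ⊗ X) ⊗≫ X ◁ (β_ (Xᘁ : C) Y).hom ▷ X ⊗≫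
          (X ⊗ Y) ◁ leftEv X ⊗≫ 𝟙 (X ⊗ Y)) := by
      rw [leftCoev_braiding_leftEv, ← whisker_exchange]; monoidal
    _ = _ := by rw [leftCoev_braiding_leftEv]; monoidal

/-- The morphism `𝟙 ⟶ (X ⊗ X*) ⊗ (Y ⊗ Y*)` that determines the negative copairing. -/
lemma copairingNeg_diagram (X Y : C) :
    (leftCoev Y ⊗≫ Y ◁ leftCoev X ▷ (Yᘁ : C) ⊗≫ 𝟙 _) ≫
      ((β_ Y X).hom ≫ (β_ X Y).hom) ▷ ((Xᘁ : C) ⊗ (Yᘁ : C)) ≫ dualShuffle Y X ≫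
        (β_ (X ⊗ (Xᘁ : C)) (Y ⊗ (Yᘁ : C))).inv =
      𝟙 (𝟙_ C) ⊗≫ (leftCoev X ⊗ₘ leftCoev Y) ⊗≫
        X ◁ (((β_ Y (Xᘁ)).inv ≫ (β_ (Xᘁ) Y).inv) ▷ Yᘁ) ⊗≫ 𝟙 ((X ⊗ Xᘁ) ⊗ (Y ⊗ Yᘁ)) := by
  have h : Y ◁ leftCoev X ≫ (α_ _ _ _).inv ≫ (β_ Y X).hom ▷ (Xᘁ : C) ≫ (α_ _ _ _).hom =
      (ρ_ Y).hom ≫ (λ_ Y).inv ≫ leftCoev X ▷ Y ≫ (α_ _ _ _).hom ≫ X ◁ (β_ Y (Xᘁ : C)).inv := by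
    have := braiding_naturality_right Y (leftCoev X) =≫
      ((α_ _ _ _).hom ≫ X ◁ (β_ Y (Xᘁ : C)).inv)
    rw [braiding_tensor_right_hom, braiding_tensorUnit_right] at this
    simpa using this
  calc
    _ = 𝟙 _ ⊗≫ leftCoev Y ⊗≫ Y ◁ leftCoev X ▷ (Yᘁ : C) ⊗≫
          ((β_ Y X).hom ≫ (β_ X Y).hom) ▷ ((Xᘁ : C) ⊗ (Yᘁ : C)) ⊗≫
          Y ◁ ((β_ (X ⊗ (Xᘁ : C)) (Yᘁ : C)).hom ≫ (β_ (X ⊗ (Xᘁ : C)) (Yᘁ : C)).inv) ⊗≫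
          (β_ (X ⊗ (Xᘁ : C)) Y).inv ▷ (Yᘁ : C) ⊗≫ 𝟙 _ := by
      rw [dualShuffle, braiding_tensor_right_inv]; monoidal
    _ = 𝟙 _ ⊗≫ leftCoev Y ⊗≫ Y ◁ leftCoev X ▷ (Yᘁ : C) ⊗≫
          ((β_ Y X).hom ≫ (β_ X Y).hom ≫ (β_ X Y).inv) ▷ ((Xᘁ : C) ⊗ (Yᘁ : C)) ⊗≫
          X ◁ (β_ (Xᘁ : C) Y).inv ▷ (Yᘁ : C) ⊗≫ 𝟙 _ := by
      rw [Iso.hom_inv_id, braiding_tensor_left_inv]; monoidal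
    _ = 𝟙 _ ⊗≫ leftCoev Y ⊗≫ (Y ◁ leftCoev X ≫ (α_ _ _ _).inv ≫ (β_ Y X).hom ▷ (Xᘁ : C) ≫
          (α_ _ _ _).hom) ▷ (Yᘁ : C) ⊗≫ X ◁ (β_ (Xᘁ : C) Y).inv ▷ (Yᘁ : C) ⊗≫ 𝟙 _ := by
      rw [Iso.hom_inv_id]; monoidal
    _ = 𝟙 _ ⊗≫ (𝟙_ C ◁ leftCoev Y ≫ leftCoev X ▷ (Y ⊗ (Yᘁ : C))) ⊗≫
          X ◁ ((β_ Y (Xᘁ : C)).inv ≫ (β_ (Xᘁ : C) Y).inv) ▷ (Yᘁ : C) ⊗≫ 𝟙 _ := by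
      rw [h]; monoidal
    _ = _ := by rw [← MonoidalCategory.tensorHom_def']

lemma dualShuffle_naturality {X Y : C} (f : X ⟶ X) (g : Y ⟶ Y) :
    (f ⊗ₘ g) ▷ ((Yᘁ : C) ⊗ (Xᘁ : C)) ≫ dualShuffle X Y =
      dualShuffle X Y ≫ (f ▷ (Xᘁ : C) ⊗ₘ g ▷ (Yᘁ : C)) := by
  rw [MonoidalCategory.tensorHom_def, MonoidalCategory.tensorHom_def', dualShuffle]
  calc
    _ = 𝟙 _ ⊗≫ f ▷ (Y ⊗ ((Yᘁ : C) ⊗ (Xᘁ : C))) ⊗≫ X ◁ (g ▷ (Yᘁ : C) ▷ (Xᘁ : C) ≫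
          (β_ (Y ⊗ (Yᘁ : C)) (Xᘁ : C)).hom) ⊗≫ 𝟙 _ := by monoidal
    _ = 𝟙 _ ⊗≫ (f ▷ ((Y ⊗ (Yᘁ : C)) ⊗ (Xᘁ : C)) ≫ X ◁ ((β_ (Y ⊗ (Yᘁ : C)) (Xᘁ : C)).hom ≫
          (Xᘁ : C) ◁ g ▷ (Yᘁ : C))) ⊗≫ 𝟙 _ := by
      rw [braiding_naturality_left]; monoidal
    _ = _ := by rw [← whisker_exchange]; monoidal

end Diagrams

/-! ### The antipode of the end -/

section Antipode

variable {C : Type u} [Category.{v} C] [MonoidalCategory C] [RigidCategory C]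

lemma exists_wedgeProj_lift {W : Wedge (tensorDualFunctor C)} (hW : IsLimit W) {Z : C}
    (s : ∀ X : C, Z ⟶ X ⊗ (Xᘁ : C))
    (hs : ∀ {X Y : C} (f : X ⟶ Y), s X ≫ f ▷ (Xᘁ : C) = s Y ≫ Y ◁ fᘁ) :
    ∃ g : Z ⟶ W.pt, ∀ X, g ≫ wedgeProj W X = s X :=
  ⟨Wedge.IsLimit.lift hW s fun _ _ f => hs f, fun X => Wedge.IsLimit.lift_ι hW s _ X⟩

lemma leftCoev_actFst_wedgeAct (W : Wedge (tensorDualFunctor C)) (X : C) :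
    W.pt ◁ leftCoev X ≫ actFst (wedgeAct W) X (Xᘁ : C) = (ρ_ _).hom ≫ wedgeProj W X :=
  leftCoev_actFst_uncurryDual (wedgeProj W) X

variable [BraidedCategory C] [RibbonCategory C] (W : Wedge (tensorDualFunctor C))

/-- The family `E ⟶ X* ⊗ X` obtained from `j_{X*}` by identifying `X**` with `X`. -/
def wedgeProjDual (X : C) : W.pt ⟶ (Xᘁ : C) ⊗ X :=
  wedgeProj W (Xᘁ : C) ≫ (Xᘁ : C) ◁ pivotalInv X

lemma wedgeProjDual_condition {X Y : C} (f : X ⟶ Y) :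
    wedgeProjDual W X ≫ (Xᘁ : C) ◁ f = wedgeProjDual W Y ≫ fᘁ ▷ Y := by
  rw [wedgeProjDual, wedgeProjDual, Category.assoc, Category.assoc,
    ← MonoidalCategory.whiskerLeft_comp, ← pivotalInv_naturality,
    MonoidalCategory.whiskerLeft_comp, ← Category.assoc, ← wedgeProj_condition, Category.assoc,
    whisker_exchange]

/-- The wedge condition at `pivotalInv X` moves it to the dual leg, where it cancels the other
pivotal isomorphism. -/
lemma wedgeProjDual_dual_pivotalInv (X : C) :
    wedgeProjDual W (Xᘁ : C) ≫ pivotalInv X ▷ (Xᘁ : C) = wedgeProj W X := by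
  rw [wedgeProjDual, Category.assoc, whisker_exchange, ← Category.assoc, wedgeProj_condition,
    Category.assoc, ← MonoidalCategory.whiskerLeft_comp, rightAdjointMate_pivotalInv]
  simp

lemma wedgeProj_twist (X : C) :
    wedgeProj W X ≫ X ◁ (twist (Xᘁ : C)).hom = wedgeProj W X ≫ (twist X).hom ▷ (Xᘁ : C) := by
  rw [twist_dual, wedgeProj_condition]

lemma RibbonCategory.twist_inv_naturality {X Y : C} (f : X ⟶ Y) :
    f ≫ (twist Y).inv = (twist X).inv ≫ f := by
  rw [Iso.comp_inv_eq, Category.assoc, twist_naturality, Iso.inv_hom_id_assoc]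

variable {W}

lemma exists_antipode (hW : IsLimit W) : ∃ S : W.pt ⟶ W.pt, ∀ X, S ≫ wedgeProj W X =
    wedgeProjDual W X ≫ (β_ (Xᘁ : C) X).hom ≫ (twist X).hom ▷ (Xᘁ : C) :=
  exists_wedgeProj_lift hW _ fun {X Y} f => by
    simp only [Category.assoc]
    rw [← comp_whiskerRight, ← twist_naturality, comp_whiskerRight,
      ← braiding_naturality_right_assoc, reassoc_of% wedgeProjDual_condition,
      braiding_naturality_left_assoc, whisker_exchange]

lemma exists_antipodeInv (hW : IsLimit W) : ∃ S : W.pt ⟶ W.pt, ∀ X, S ≫ wedgeProj W X =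
    wedgeProjDual W X ≫ (β_ X (Xᘁ : C)).inv ≫ (twist X).inv ▷ (Xᘁ : C) :=
  exists_wedgeProj_lift hW _ fun {X Y} f => by
    simp only [Category.assoc]
    rw [← comp_whiskerRight, ← twist_inv_naturality, comp_whiskerRight,
      ← braiding_inv_naturality_right_assoc, reassoc_of% wedgeProjDual_condition,
      braiding_inv_naturality_left_assoc, whisker_exchange]

/-- At `X` the composite meets the antipode at `Xᘁ`. The double dual is removed by
`wedgeProjDual_dual_pivotalInv`, the braidings cancel, and `wedgeProj_twist` puts both twists on the
same leg. -/
lemma antipode_comp_antipodeInv (hW : IsLimit W) {S T : W.pt ⟶ W.pt}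
    (hS : ∀ X, S ≫ wedgeProj W X =
      wedgeProjDual W X ≫ (β_ (Xᘁ : C) X).hom ≫ (twist X).hom ▷ (Xᘁ : C))
    (hT : ∀ X, T ≫ wedgeProj W X =
      wedgeProjDual W X ≫ (β_ X (Xᘁ : C)).inv ≫ (twist X).inv ▷ (Xᘁ : C)) :
    S ≫ T = 𝟙 W.pt := wedgeProj_hom_ext hW fun X => by
  rw [Category.assoc, hT, wedgeProjDual, Category.assoc, reassoc_of% hS, ← whisker_exchange_assoc,
    ← braiding_naturality_left_assoc, reassoc_of% wedgeProjDual_dual_pivotalInv,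
    braiding_inv_naturality_left_assoc, Iso.hom_inv_id_assoc, reassoc_of% wedgeProj_twist,
    ← comp_whiskerRight, Iso.hom_inv_id]
  simp

lemma antipodeInv_comp_antipode (hW : IsLimit W) {S T : W.pt ⟶ W.pt}
    (hS : ∀ X, S ≫ wedgeProj W X =
      wedgeProjDual W X ≫ (β_ (Xᘁ : C) X).hom ≫ (twist X).hom ▷ (Xᘁ : C))
    (hT : ∀ X, T ≫ wedgeProj W X =
      wedgeProjDual W X ≫ (β_ X (Xᘁ : C)).inv ≫ (twist X).inv ▷ (Xᘁ : C)) :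
    T ≫ S = 𝟙 W.pt := wedgeProj_hom_ext hW fun X => by
  rw [Category.assoc, hS, wedgeProjDual, Category.assoc, reassoc_of% hT, ← whisker_exchange_assoc,
    ← braiding_inv_naturality_left_assoc, reassoc_of% wedgeProjDual_dual_pivotalInv,
    braiding_naturality_left_assoc, Iso.inv_hom_id_assoc, whisker_exchange,
    ← reassoc_of% wedgeProj_twist, ← MonoidalCategory.whiskerLeft_comp, Iso.hom_inv_id]
  simp

/-- This matches the diagram for the antipode with its implicit description: the coevaluation is a
braided and twisted `rightCoev`, which turns an action on the second leg into one on the first. -/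
lemma leftCoev_actSnd_wedgeAct (W : Wedge (tensorDualFunctor C)) (X : C) :
    W.pt ◁ leftCoev X ≫ actSnd (wedgeAct W) X (Xᘁ : C) =
      (ρ_ _).hom ≫ wedgeProjDual W X ≫ (β_ (Xᘁ : C) X).hom ≫ (twist X).hom ▷ (Xᘁ : C) := by
  rw [wedgeProjDual, Category.assoc, ← reassoc_of% leftCoev_actFst_wedgeAct,
    ← reassoc_of% actFst_naturality_right, ← whiskerLeft_comp_assoc, leftCoev_dual_pivotalInv,
    ← rightCoev_braiding_twist, MonoidalCategory.whiskerLeft_comp,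
    MonoidalCategory.whiskerLeft_comp, Category.assoc, Category.assoc, actSnd_naturality_left,
    actSnd]
  simp

end Antipode

/-! ### The structure morphisms of the end -/

section EndStructure

variable {C : Type u} [Category.{v} C] [MonoidalCategory C] [RigidCategory C] [BraidedCategory C]
  {W : Wedge (tensorDualFunctor C)}

lemma tensorHom_wedgeProj_leftCap (W : Wedge (tensorDualFunctor C)) {Z : C} (f : Z ⟶ W.pt ⊗ W.pt)
    (X Y : C) :
    (f ≫ (wedgeProj W X ⊗ₘ wedgeProj W Y)) ▷ (X ⊗ Y) ≫ tensorμ _ _ X Y ≫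
      (leftCap X ⊗ₘ leftCap Y) = f ▷ (X ⊗ Y) ≫ actTensor (wedgeAct W) X Y := by
  rw [comp_whiskerRight_assoc, tensorHom_leftCap]
  rfl

lemma tensorHom_wedgeProj_hom_ext (hW : IsLimit W) {Z : C} {f g : Z ⟶ W.pt ⊗ W.pt}
    (h : ∀ X Y, f ≫ (wedgeProj W X ⊗ₘ wedgeProj W Y) = g ≫ (wedgeProj W X ⊗ₘ wedgeProj W Y)) :
    f = g :=
  (isUniversalAction_wedgeAct hW).hom_ext₂ fun X Y => by
    rw [← tensorHom_wedgeProj_leftCap, h, tensorHom_wedgeProj_leftCap]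

variable [RibbonCategory C] {D : BPRibbonData W.pt}

/-- The `j_X` are jointly monic, and so are the `j_X ⊗ j_Y`. -/
lemma IsEndStructure.unique (hW : IsLimit W) {D' : BPRibbonData W.pt}
    (h' : IsEndStructure (wedgeProj W) D') (h : IsEndStructure (wedgeProj W) D) : D' = D := by
  apply BPRibbonData.ext
  · exact wedgeProj_hom_ext hW fun X => by rw [h'.mul, h.mul]
  · exact wedgeProj_hom_ext hW fun X => by rw [h'.one, h.one]
  · exact tensorHom_wedgeProj_hom_ext hW fun X Y => by rw [h'.comul, h.comul]
  · rw [h'.counit, h.counit]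
  · exact wedgeProj_hom_ext hW fun X => by rw [h'.antipode, h.antipode]
  · exact wedgeProj_hom_ext hW fun X => by rw [h'.antipodeInv, h.antipodeInv]
  · exact wedgeProj_hom_ext hW fun X => by rw [h'.ribbon, h.ribbon]
  · exact wedgeProj_hom_ext hW fun X => by rw [h'.ribbonInv, h.ribbonInv]
  · exact tensorHom_wedgeProj_hom_ext hW fun X Y => by rw [h'.copairing, h.copairing]
  · exact tensorHom_wedgeProj_hom_ext hW fun X Y => by rw [h'.copairingNeg, h.copairingNeg]

namespace IsActionStructure

lemma ribbon_wedgeProj (hD : IsActionStructure (wedgeAct W) D) (X : C) :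
    D.ribbon ≫ wedgeProj W X = leftCoev X ≫ (twist X).inv ▷ (Xᘁ : C) :=
  uncurryDual_injective <| by
    rw [uncurryDual_comp_left, uncurryDual_comp_right, uncurryDual_leftCoev]
    exact hD.ribbon X

lemma ribbonInv_wedgeProj (hD : IsActionStructure (wedgeAct W) D) (X : C) :
    D.ribbonInv ≫ wedgeProj W X = leftCoev X ≫ (twist X).hom ▷ (Xᘁ : C) :=
  uncurryDual_injective <| by
    rw [uncurryDual_comp_left, uncurryDual_comp_right, uncurryDual_leftCoev]
    exact hD.ribbonInv X

lemma leftMul_ribbon_wedgeProj (hD : IsActionStructure (wedgeAct W) D) (X : C) :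
    D.leftMul D.ribbon ≫ wedgeProj W X = wedgeProj W X ≫ (twist X).inv ▷ (Xᘁ : C) :=
  uncurryDual_injective <| by
    rw [uncurryDual_comp_left, uncurryDual_comp_right]
    exact hD.leftMul_act (hD.ribbon X)

lemma comul_wedgeProj (hD : IsActionStructure (wedgeAct W) D) (X Y : C) :
    D.comul ≫ (wedgeProj W X ⊗ₘ wedgeProj W Y) =
      wedgeProj W (X ⊗ Y) ⊗≫ (X ⊗ Y) ◁ (dualTensorIso X Y).hom ⊗≫
        X ◁ (β_ (Y ⊗ Yᘁ) (Xᘁ)).hom ⊗≫ 𝟙 ((X ⊗ Xᘁ) ⊗ (Y ⊗ Yᘁ)) :=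
  hom_ext_leftCap <| by
    rw [tensorHom_wedgeProj_leftCap, hD.comul, comul_diagram_leftCap]
    rfl

lemma comul_wedgeProj_dualShuffle (hD : IsActionStructure (wedgeAct W) D) (X Y : C) :
    D.comul ≫ (wedgeProj W X ⊗ₘ wedgeProj W Y) =
      wedgeProj W (X ⊗ Y) ≫ (X ⊗ Y) ◁ (dualTensorIso X Y).hom ≫ dualShuffle X Y := by
  rw [hD.comul_wedgeProj, dualShuffle]
  monoidal

lemma copairing_wedgeProj (hD : IsActionStructure (wedgeAct W) D) (X Y : C) :
    D.copairing ≫ (wedgeProj W X ⊗ₘ wedgeProj W Y) =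
      𝟙 (𝟙_ C) ⊗≫ (leftCoev X ⊗ₘ leftCoev Y) ⊗≫
        X ◁ (((β_ (Xᘁ) Y).hom ≫ (β_ Y (Xᘁ)).hom) ▷ Yᘁ) ⊗≫ 𝟙 ((X ⊗ Xᘁ) ⊗ (Y ⊗ Yᘁ)) :=
  hom_ext_leftCap <| by
    rw [tensorHom_wedgeProj_leftCap, hD.copairing, copairing_diagram_leftCap]

/-- Moving `c⁻¹` to the end evaluates the rest at `Y ⊗ X`, where the twist of `Y ⊗ X` and the
inverse twists of its factors leave a double braiding. -/
lemma copairingNeg_wedgeProj (hW : IsLimit W) (hD : IsActionStructure (wedgeAct W) D) (X Y : C) :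
    (D.ribbonInv ≫ D.comul ≫ (β_ W.pt W.pt).inv ≫
      (D.leftMul D.ribbon ⊗ₘ D.rightMul D.ribbon)) ≫ (wedgeProj W X ⊗ₘ wedgeProj W Y) =
      𝟙 (𝟙_ C) ⊗≫ (leftCoev X ⊗ₘ leftCoev Y) ⊗≫
        X ◁ (((β_ Y (Xᘁ)).inv ≫ (β_ (Xᘁ) Y).inv) ▷ Yᘁ) ⊗≫ 𝟙 ((X ⊗ Xᘁ) ⊗ (Y ⊗ Yᘁ)) := by
  have htwist : (twist (Y ⊗ X)).hom ≫ ((twist Y).inv ⊗ₘ (twist X).inv) =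
      (β_ Y X).hom ≫ (β_ X Y).hom := by
    rw [twist_tensor, Category.assoc, Category.assoc, tensorHom_comp_tensorHom]
    simp
  simp only [Category.assoc]
  rw [← hD.ribbon_central (isUniversalAction_wedgeAct hW), tensorHom_comp_tensorHom,
    hD.leftMul_ribbon_wedgeProj, hD.leftMul_ribbon_wedgeProj, ← tensorHom_comp_tensorHom,
    ← braiding_inv_naturality_assoc, ← braiding_inv_naturality,
    reassoc_of% hD.comul_wedgeProj_dualShuffle,
    reassoc_of% hD.ribbonInv_wedgeProj, ← whisker_exchange_assoc,
    reassoc_of% leftCoev_tensor_dualTensorIso,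
    ← reassoc_of% (dualShuffle_naturality (twist Y).inv (twist X).inv), ← comp_whiskerRight_assoc,
    htwist]
  exact copairingNeg_diagram X Y

lemma isEndStructure (hW : IsLimit W) (hD : IsActionStructure (wedgeAct W) D)
    (hS : ∀ X, D.antipode ≫ wedgeProj W X =
      wedgeProjDual W X ≫ (β_ (Xᘁ : C) X).hom ≫ (twist X).hom ▷ (Xᘁ : C))
    (hT : ∀ X, D.antipodeInv ≫ wedgeProj W X =
      wedgeProjDual W X ≫ (β_ X (Xᘁ : C)).inv ≫ (twist X).inv ▷ (Xᘁ : C))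
    (hw : D.copairingNeg = D.ribbonInv ≫ D.comul ≫ (β_ W.pt W.pt).inv ≫
      (D.leftMul D.ribbon ⊗ₘ D.rightMul D.ribbon)) :
    IsEndStructure (wedgeProj W) D where
  mul X := uncurryDual_injective <| by
    rw [uncurryDual_comp_left, uncurryDual_mul_diagram]
    exact hD.mul X
  one X := uncurryDual_injective <| by
    rw [uncurryDual_comp_left, uncurryDual_leftCoev]
    exact hD.one X
  comul := hD.comul_wedgeProj
  counit := by
    rw [← cancel_epi (ρ_ W.pt).hom, ← hD.counit, ← uncurryDual_counit_diagram]
    rfl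
  antipode X := by rw [hS, wedgeProjDual, Category.assoc]
  antipodeInv X := by rw [hT, wedgeProjDual, Category.assoc]
  ribbon := hD.ribbon_wedgeProj
  ribbonInv := hD.ribbonInv_wedgeProj
  copairing := hD.copairing_wedgeProj
  copairingNeg X Y := by rw [hw, hD.copairingNeg_wedgeProj hW]

/-- The Hopf algebra structure underlying structure morphisms described by their action. -/
@[reducible]
def hopfObj {E : C} {a : ∀ X : C, E ⊗ X ⟶ X} {D : BPRibbonData E} (ha : IsUniversalAction a)
    (hD : IsActionStructure a D) : HopfObj E where
  one := D.one
  mul := D.mul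
  one_mul := hD.one_mul ha
  mul_one := hD.mul_one ha
  mul_assoc := hD.mul_associative ha
  counit := D.counit
  comul := D.comul
  counit_comul := hD.counit_comul ha
  comul_counit := hD.comul_counit ha
  comul_assoc := hD.comul_coassociative ha
  mul_comul := hD.mul_comul ha
  one_comul := hD.one_comul ha
  mul_counit := hD.mul_counit
  one_counit := hD.one_counit
  antipode := D.antipode
  antipode_left := hD.antipode_left ha
  antipode_right := hD.antipode_right ha

lemma isBPRibbonHopf {E : C} {a : ∀ X : C, E ⊗ X ⟶ X} {D : BPRibbonData E}
    (ha : IsUniversalAction a) (hD : IsActionStructure a D)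
    (hST : D.antipode ≫ D.antipodeInv = 𝟙 E) (hTS : D.antipodeInv ≫ D.antipode = 𝟙 E)
    (hw : D.copairingNeg = D.ribbonInv ≫ D.comul ≫ (β_ E E).inv ≫
      (D.leftMul D.ribbon ⊗ₘ D.rightMul D.ribbon)) :
    D.IsBPRibbonHopf where
  hopf := ⟨hopfObj ha hD, rfl, rfl, rfl, rfl, rfl⟩
  antipode_antipodeInv := hST
  antipodeInv_antipode := hTS
  copairing_eq := hD.copairing_eq ha
  copairingNeg_eq := hw
  ribbon_central := hD.ribbon_central ha
  ribbon_ribbonInv := hD.ribbon_ribbonInv ha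
  ribbonInv_ribbon := hD.ribbonInv_ribbon ha
  ribbon_counit := hD.ribbon_counit
  ribbon_antipode := hD.ribbon_antipode ha
  copairing_comul_left := hD.copairing_comul_left ha
  copairing_comul_right := hD.copairing_comul_right ha
  copairing_counit_left := hD.copairing_counit_left ha
  copairing_counit_right := hD.copairing_counit_right ha
  ribbon_comul := hD.ribbon_comul ha
  copairing_braiding := hD.copairing_braiding ha

end IsActionStructure

lemma exists_isEndStructure_isBPRibbonHopf (hW : IsLimit W) :
    ∃ D : BPRibbonData W.pt, IsEndStructure (wedgeProj W) D ∧ D.IsBPRibbonHopf := by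
  have ha := isUniversalAction_wedgeAct hW
  obtain ⟨mul, hmul⟩ := ha.exists_lift
    (fun X => (α_ _ _ _).hom ≫ W.pt ◁ wedgeAct W X ≫ wedgeAct W X) fun f => by
      rw [tensor_whiskerLeft]
      simp only [Category.assoc, Iso.inv_hom_id_assoc]
      rw [← whiskerLeft_comp_assoc, ha.naturality f, MonoidalCategory.whiskerLeft_comp,
        Category.assoc, ha.naturality f]
  obtain ⟨one, hone⟩ := ha.exists_lift (fun X => (λ_ X).hom) fun f => by simp
  obtain ⟨comul, hcomul⟩ := ha.exists_lift₂ (fun X Y => wedgeAct W (X ⊗ Y)) fun f g =>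
    ha.naturality _
  obtain ⟨ribbon, hribbon⟩ := ha.exists_lift (fun X => (λ_ X).hom ≫ (twist X).inv) fun f => by
    rw [leftUnitor_naturality_assoc, twist_inv_naturality, Category.assoc]
  obtain ⟨ribbonInv, hribbonInv⟩ := ha.exists_lift
    (fun X => (λ_ X).hom ≫ (twist X).hom) fun f => by
      rw [leftUnitor_naturality_assoc, twist_naturality, Category.assoc]
  obtain ⟨copairing, hcopairing⟩ := ha.exists_lift₂
    (fun X Y => (λ_ _).hom ≫ (β_ Y X).inv ≫ (β_ X Y).inv) fun f g => by
      simp only [leftUnitor_naturality_assoc, Category.assoc, braiding_inv_naturality_assoc,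
        braiding_inv_naturality]
  obtain ⟨S, hS⟩ := exists_antipode hW
  obtain ⟨T, hT⟩ := exists_antipodeInv hW
  let D₀ : BPRibbonData W.pt :=
    { mul := mul
      one := one
      comul := comul
      counit := wedgeProj W (𝟙_ C) ≫ (λ_ _).hom ≫ (ρ_ _).inv ≫ leftEv (𝟙_ C)
      antipode := S
      antipodeInv := T
      ribbon := ribbon
      ribbonInv := ribbonInv
      copairing := copairing
      copairingNeg := copairing }
  let D : BPRibbonData W.pt :=
    { D₀ with
      copairingNeg := ribbonInv ≫ comul ≫ (β_ W.pt W.pt).inv ≫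
        (D₀.leftMul ribbon ⊗ₘ D₀.rightMul ribbon) }
  have hD : IsActionStructure (wedgeAct W) D :=
    { mul := hmul
      one := hone
      comul := hcomul
      counit := uncurryDual_counit_diagram (wedgeProj W)
      antipode := fun X => by
        rw [leftCoev_actSnd_wedgeAct, ← hS, whisker_exchange_assoc, leftCoev_actFst_wedgeAct,
          rightUnitor_naturality_assoc]
      ribbon := hribbon
      ribbonInv := hribbonInv
      copairing := hcopairing }
  exact ⟨D, hD.isEndStructure hW hS hT rfl, hD.isBPRibbonHopf ha
    (antipode_comp_antipodeInv hW hS hT) (antipodeInv_comp_antipode hW hS hT) rfl⟩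

end EndStructure

end Proofs

theorem propositionP {k : Type w} [Field k] [IsAlgClosed k]
    {C : Type u} [Category.{v} C] [Preadditive C] [Linear k C]
    [MonoidalCategory C] [MonoidalPreadditive C] [MonoidalLinear k C]
    [RigidCategory C] [BraidedCategory C] [RibbonCategory C]
    (hC : IsUnimodularCategory k C) :
    HasEnd (tensorDualFunctor C) ∧
    ∀ W : Wedge (tensorDualFunctor C), Nonempty (IsLimit W) →
      ∃ D : BPRibbonData W.pt,
        IsEndStructure (wedgeProj W) D ∧
        (∀ D' : BPRibbonData W.pt, IsEndStructure (wedgeProj W) D' → D' = D) ∧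
        D.IsBPRibbonHopf := by
  obtain ⟨P, hP⟩ := hC.finite.exists_isDenseGenerator
  obtain ⟨E, a, ha⟩ := hP.exists_isUniversalAction hC.finite.hasJointEqualizers
  refine ⟨ha.hasEnd, fun W ⟨hW⟩ => ?_⟩
  obtain ⟨D, hD, hopf⟩ := exists_isEndStructure_isBPRibbonHopf hW
  exact ⟨D, hD, fun D' hD' => hD'.unique hW hD, hopf⟩
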